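/- Let $k\ge 2$, $0<\delta<1/k$ and $\delta\le\pi^*\le 1/k$. Let $\mathbb{M}^k_{\delta,\pi^*}$ be the collection of all Markov chains over $[k]=\{1,\dots,k\}$, with an arbitrary initial distribution and a transition matrix $M$ such that $M_{ij}\ge\delta$ for all $i,j\in[k]$, whose stationary distribution $\pi$ satisfies $\min_{i\in[k]}\pi_i=\pi^*$. An estimator $\hat M$ maps each sequence $x^n\in[k]^n$ to a transition matrix $\hat M_{x^n}$ over $[k]\times[k]$. For a sample $X^n=(X_1,\dots,X_n)$ of the chain, let $$r_i(M,\hat M)=\mathbb{E}_{X^n\sim(M)}\Big[\sum_{j\in[k]}\big(M_{ij}-\hat M_{X^n}(i,j)\big)^2\Big]$$ be the expected squared-$L_2$ loss at state $i$, and define the minimax stationary-weighted and worst-state estimation risks $$\tilde\varepsilon_n=\min_{\hat M}\ \max_{(M)\in\mathbb{M}^k_{\delta,\pi^*}}\ \sum_{i\in[k]}\pi_i\, r_i(M,\hat M),\qquad \varepsilon_n=\min_{\hat M}\ \max_{(M)\in\mathbb{M}^k_{\delta,\pi^*}}\ \max_{i\in[k]}\, r_i(M,\hat M).$$ Write $a_n\lesssim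 b_n$ if $a_n\le b_n(1+o(1))$ as $n\to\infty$, with $k,\delta,\pi^*$ fixed. Then $$(1-\pi^*)^2\,\frac{k-\frac{k}{k-1}}{n}\ \lesssim\ \tilde\varepsilon_n\ \lesssim\ \frac{k-1}{n}$$ and $$(1-\pi^*)^2\,\frac{1-\frac1{k-1}}{n\pi^*}\ \lesssim\ \varepsilon_n\ \lesssim\ \frac{1-\frac1k}{n\pi^*}.$$ -/

import Mathlib

open Filter Topology

/-- A time-homogeneous Markov chain over `k` states: an arbitrary initial distribution `init`,
a transition matrix `trans`, and a stationary distribution `stat` of `trans`. When all transition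
probabilities are positive, `stat` is determined by `trans` (see `stationary_unique`). -/
structure MarkovChain (k : ℕ) where
  init : Fin k → ℝ
  trans : Matrix (Fin k) (Fin k) ℝ
  stat : Fin k → ℝ
  init_mem : init ∈ stdSimplex ℝ (Fin k)
  trans_mem : trans ∈ Matrix.rowStochastic ℝ (Fin k)
  stat_mem : stat ∈ stdSimplex ℝ (Fin k)
  stat_vecMul : Matrix.vecMul stat trans = stat

/-- A transition matrix with positive entries has at most one stationary distribution. -/
theorem stationary_unique {k : ℕ} {M : Matrix (Fin k) (Fin k) ℝ}
    (hM : M ∈ Matrix.rowStochastic ℝ (Fin k)) {δ : ℝ} (hδ : 0 < δ) (hMδ : ∀ i j, δ ≤ M i j)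
    {p q : Fin k → ℝ} (hp : p ∈ stdSimplex ℝ (Fin k)) (hq : q ∈ stdSimplex ℝ (Fin k))
    (hpM : Matrix.vecMul p M = p) (hqM : Matrix.vecMul q M = q) : p = q := by
  have key : ∀ j, |p j - q j| ≤ ∑ i, |p i - q i| * (M i j - δ) := by
    intro j
    have h1 : p j - q j = ∑ i, (p i - q i) * (M i j - δ) := by
      have e1 : p j = ∑ i, p i * M i j := by
        conv_lhs => rw [← hpM]
        rfl
      have e2 : q j = ∑ i, q i * M i j := by
        conv_lhs => rw [← hqM]
        rfl
      simp only [sub_mul, mul_sub, Finset.sum_sub_distrib, ← Finset.sum_mul, hp.2, hq.2]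
      rw [← e1, ← e2]
      ring
    rw [h1]
    refine (Finset.abs_sum_le_sum_abs _ _).trans (Finset.sum_le_sum fun i _ => ?_)
    rw [abs_mul, abs_of_nonneg (sub_nonneg.2 (hMδ i j))]
  have h2 : ∑ j, |p j - q j| ≤ ∑ j, ∑ i, |p i - q i| * (M i j - δ) :=
    Finset.sum_le_sum fun j _ => key j
  rw [Finset.sum_comm] at h2
  simp only [← Finset.mul_sum, Finset.sum_sub_distrib,
    Matrix.sum_row_of_mem_rowStochastic hM, Finset.sum_const, Finset.card_univ,
    Fintype.card_fin, nsmul_eq_mul, ← Finset.sum_mul] at h2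
  have h0 : 0 ≤ ∑ j, |p j - q j| := Finset.sum_nonneg fun j _ => abs_nonneg _
  funext j
  have hk : (0 : ℝ) < k := by exact_mod_cast (Fin.pos j)
  have h3 : ∑ j, |p j - q j| = 0 := by nlinarith [mul_pos hk hδ]
  have h4 := (Finset.sum_eq_zero_iff_of_nonneg (fun j _ => abs_nonneg (p j - q j))).1 h3 j
    (Finset.mem_univ j)
  exact sub_eq_zero.1 (abs_eq_zero.1 h4)

namespace MarkovChain

/-- The probability that the first `n` states of the chain are `x 0, …, x (n - 1)`. -/
def pathProb {k : ℕ} (C : MarkovChain k) : (n : ℕ) → (Fin n → Fin k) → ℝ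
  | 0, _ => 1
  | m + 1, x => C.init (x 0) * ∏ t : Fin m, C.trans (x t.castSucc) (x t.succ)

/-- The chains over `k` states whose transition probabilities are all at least `δ`. -/
def lowerBounded (k : ℕ) (δ : ℝ) : Set (MarkovChain k) :=
  {C | ∀ i j, δ ≤ C.trans i j}

/-- The chains in `lowerBounded k δ` whose smallest stationary probability equals `pmin`. -/
def lowerBoundedStat (k : ℕ) (δ pmin : ℝ) : Set (MarkovChain k) :=
  {C | C ∈ lowerBounded k δ ∧ IsLeast (Set.range C.stat) pmin}

end MarkovChain

/-- An estimator of the transition matrix from a sample of length `n` over `k` states. -/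
abbrev TransitionEstimator (k n : ℕ) : Type :=
  (Fin n → Fin k) → Matrix.rowStochastic ℝ (Fin k)

/-- The squared Euclidean distance of two distributions on `k` points. -/
def l2Loss {k : ℕ} (p q : Fin k → ℝ) : ℝ := ∑ j, (p j - q j) ^ 2

/-- The expected squared-`L₂` loss at state `i`, for a sample of length `n` from the chain. -/
def stateRisk {k n : ℕ} (C : MarkovChain k) (E : TransitionEstimator k n) (i : Fin k) : ℝ :=
  ∑ x : Fin n → Fin k, C.pathProb n x * l2Loss (C.trans i) ((E x : Matrix (Fin k) (Fin k) ℝ) i)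

/-- The worst-state estimation risk. -/
noncomputable def worstStateRisk {k n : ℕ} (C : MarkovChain k) (E : TransitionEstimator k n) : ℝ :=
  ⨆ i : Fin k, stateRisk C E i

/-- The stationary-weighted estimation risk. -/
def weightedRisk {k n : ℕ} (C : MarkovChain k) (E : TransitionEstimator k n) : ℝ :=
  ∑ i : Fin k, C.stat i * stateRisk C E i

/-- The minimax worst-state estimation risk over a class of chains, for samples of length `n`. -/
noncomputable def minimaxWorstStateRisk {k : ℕ} (𝓜 : Set (MarkovChain k)) (n : ℕ) : ℝ :=
  ⨅ E : TransitionEstimator k n, ⨆ C : 𝓜, worstStateRisk C.1 E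

/-- The minimax stationary-weighted estimation risk over a class of chains, for samples of
length `n`. -/
noncomputable def minimaxWeightedRisk {k : ℕ} (𝓜 : Set (MarkovChain k)) (n : ℕ) : ℝ :=
  ⨅ E : TransitionEstimator k n, ⨆ C : 𝓜, weightedRisk C.1 E

/-- `a ≤ b (1 + o(1))` as `n → ∞`. -/
def AsympLE (a b : ℕ → ℝ) : Prop :=
  ∃ r : ℕ → ℝ, Tendsto r atTop (𝓝 0) ∧ ∀ᶠ n in atTop, a n ≤ b n * (1 + r n)

/-!
For the upper bounds, let `N_i` be the number of visits to `i` and `N_ij` the number of transitions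
from `i` to `j`. The numerators `N_ij - M_ij * N_i` of the errors of the empirical estimator are
martingales, so that their second moments sum to
`(1 - ∑ j, M_ij ^ 2) * E[N_i] ≤ (1 - 1 / k) * E[N_i]`. Through the Poisson equation, whose solution
is bounded by `1 / δ`, one has `E[N_i] = n * π_i + O(1)`, and an exponential moment shows that
`N_i < (1 - ε) * n * π_i` has exponentially small probability, uniformly over the chains. Hence the
risk at `i` is at most `(1 - 1 / k) / (n * π_i)`, up to a factor `1 + o(1)`.

For the lower bounds, perturb the chain whose states are independent with law `c` along orthonormal
directions `V` of matrices with vanishing row sums, the steps being of order `1 / √n`. The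
chi-square divergence between the laws of the paths of neighbouring chains is at most
`exp (n * s ^ 2 * I) - 1` in the limit, where `s` is the step and `I` is the Fisher information of
the direction. A discrete van Trees inequality for the uniform prior on the grid then makes any
constant below `1 / I` over `n` a lower bound for the risk in that direction, and Bessel's
inequality adds up the directions. If `pmin < 1 / k`, then `c` has mass `pmin` at one state and is
uniform elsewhere, and the directions vanish in the column of that state, which fixes the smallest
stationary probability. If `pmin = 1 / k`, then `c` is uniform and the directions also have
vanishing column sums, which keeps the stationary distribution uniform.
-/

section PathSums

variable {α : Type*}

/-- The product of the weights `W` along the transitions of the path `x`. -/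
def pathWeight (W : Matrix α α ℝ) {m : ℕ} (x : Fin (m + 1) → α) : ℝ :=
  ∏ t : Fin m, W (x t.castSucc) (x t.succ)

/-- The additive functional of the path `x` that sums `g` over its transitions. -/
def pathSum (g : α → α → ℝ) {m : ℕ} (x : Fin (m + 1) → α) : ℝ :=
  ∑ t : Fin m, g (x t.castSucc) (x t.succ)

variable {W : Matrix α α ℝ} {g : α → α → ℝ} {m : ℕ}

theorem pathWeight_cons (W : Matrix α α ℝ) (a : α) (x : Fin (m + 1) → α) :
    pathWeight W (Fin.cons a x : Fin (m + 2) → α) = W a (x 0) * pathWeight W x := by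
  simp [pathWeight, Fin.prod_univ_succ]

theorem pathSum_cons (g : α → α → ℝ) (a : α) (x : Fin (m + 1) → α) :
    pathSum g (Fin.cons a x : Fin (m + 2) → α) = g a (x 0) + pathSum g x := by
  simp [pathSum, Fin.sum_univ_succ]

theorem pathWeight_nonneg (hW : ∀ i j, 0 ≤ W i j) (x : Fin (m + 1) → α) : 0 ≤ pathWeight W x :=
  Finset.prod_nonneg fun _ _ => hW _ _

theorem pathSum_nonneg (hg : ∀ i j, 0 ≤ g i j) (x : Fin (m + 1) → α) : 0 ≤ pathSum g x :=
  Finset.sum_nonneg fun _ _ => hg _ _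

theorem pathWeight_mul_exp_pathSum (W : Matrix α α ℝ) (g : α → α → ℝ) (x : Fin (m + 1) → α) :
    pathWeight W x * Real.exp (pathSum g x) =
      pathWeight (.of fun i j => W i j * Real.exp (g i j)) x := by
  simp only [pathWeight, pathSum, Real.exp_sum, Finset.prod_mul_distrib, Matrix.of_apply]

theorem pathWeight_sq_div_pathWeight (W' W : Matrix α α ℝ) (x : Fin (m + 1) → α) :
    pathWeight W' x ^ 2 / pathWeight W x =
      pathWeight (.of fun i j => W' i j ^ 2 / W i j) x := by
  simp only [pathWeight, Finset.prod_div_distrib, Finset.prod_pow, Matrix.of_apply]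

variable [Fintype α]

theorem sum_fin_succ_pi (F : (Fin (m + 1) → α) → ℝ) :
    ∑ x, F x = ∑ a, ∑ y : Fin m → α, F (Fin.cons a y) := by
  rw [← Fintype.sum_prod_type']
  exact (Fintype.sum_equiv (Fin.consEquiv fun _ : Fin (m + 1) => α) _ _ fun _ => rfl).symm

/-- The `W`-weighted sum of `F` over all paths with `m` transitions that start at `a`. When `W` is
a stochastic matrix, it is the expectation of `F` under the chain started at `a`. -/
def pathExp (W : Matrix α α ℝ) (m : ℕ) (a : α) (F : (Fin (m + 1) → α) → ℝ) : ℝ :=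
  ∑ y : Fin m → α, pathWeight W (Fin.cons a y : Fin (m + 1) → α) * F (Fin.cons a y)

theorem pathExp_zero (W : Matrix α α ℝ) (a : α) (F : (Fin 1 → α) → ℝ) :
    pathExp W 0 a F = F fun _ => a := by
  have h (y : Fin 0 → α) : (Fin.cons a y : Fin 1 → α) = fun _ => a :=
    funext fun t => by rw [Fin.eq_zero t]; rfl
  simp only [pathExp, h, pathWeight, Finset.univ_eq_empty, Finset.prod_empty, one_mul,
    Fintype.sum_unique]

theorem pathExp_succ (W : Matrix α α ℝ) (m : ℕ) (a : α) (F : (Fin (m + 2) → α) → ℝ) :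
    pathExp W (m + 1) a F = ∑ b, W a b * pathExp W m b fun x => F (Fin.cons a x) := by
  simp only [pathExp]
  rw [sum_fin_succ_pi]
  simp only [pathWeight_cons W a, Fin.cons_zero, Finset.mul_sum, mul_assoc]

theorem pathExp_congr {a : α} {F G : (Fin (m + 1) → α) → ℝ} (h : ∀ x, x 0 = a → F x = G x) :
    pathExp W m a F = pathExp W m a G :=
  Finset.sum_congr rfl fun y _ => by rw [h _ (by rw [Fin.cons_zero])]

theorem pathExp_exp_pathSum (W : Matrix α α ℝ) (g : α → α → ℝ) (m : ℕ) (a : α) :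
    (pathExp W m a fun x => Real.exp (pathSum g x)) =
      pathExp (.of fun i j => W i j * Real.exp (g i j)) m a fun _ => 1 :=
  Finset.sum_congr rfl fun y _ => by rw [mul_one, pathWeight_mul_exp_pathSum]

theorem pathExp_mono (hW : ∀ i j, 0 ≤ W i j) (a : α) {F G : (Fin (m + 1) → α) → ℝ}
    (h : ∀ x, F x ≤ G x) : pathExp W m a F ≤ pathExp W m a G :=
  Finset.sum_le_sum fun _ _ => mul_le_mul_of_nonneg_left (h _) (pathWeight_nonneg hW _)

theorem pathExp_add (W : Matrix α α ℝ) (a : α) (F G : (Fin (m + 1) → α) → ℝ) :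
    (pathExp W m a fun x => F x + G x) = pathExp W m a F + pathExp W m a G := by
  simp only [pathExp, mul_add, Finset.sum_add_distrib]

theorem pathExp_const_mul (W : Matrix α α ℝ) (a : α) (c : ℝ) (F : (Fin (m + 1) → α) → ℝ) :
    (pathExp W m a fun x => c * F x) = c * pathExp W m a F := by
  simp only [pathExp, Finset.mul_sum, mul_left_comm c]

theorem pathExp_sum {ι : Type*} (W : Matrix α α ℝ) (a : α) (s : Finset ι)
    (F : ι → (Fin (m + 1) → α) → ℝ) :
    (pathExp W m a fun x => ∑ i ∈ s, F i x) = ∑ i ∈ s, pathExp W m a (F i) := by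
  simp only [pathExp, Finset.mul_sum]
  exact Finset.sum_comm

/-- A supersolution `f ≥ 1` of the eigenvalue equation of `W` controls the growth of the total
weight of the paths. -/
theorem pathExp_one_le_pow_mul (hW : ∀ i j, 0 ≤ W i j) {f : α → ℝ} {r : ℝ} (hr : 0 ≤ r)
    (hf : ∀ a, 1 ≤ f a) (hWf : ∀ a, ∑ b, W a b * f b ≤ r * f a) (m : ℕ) (a : α) :
    (pathExp W m a fun _ => 1) ≤ r ^ m * f a := by
  induction m generalizing a with
  | zero => simpa only [pathExp_zero, pow_zero, one_mul] using hf a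
  | succ m ih =>
    calc (pathExp W (m + 1) a fun _ => 1) = ∑ b, W a b * pathExp W m b fun _ => 1 :=
          pathExp_succ W m a _
      _ ≤ ∑ b, W a b * (r ^ m * f b) :=
          Finset.sum_le_sum fun b _ => mul_le_mul_of_nonneg_left (ih b) (hW a b)
      _ = r ^ m * ∑ b, W a b * f b := by simp only [Finset.mul_sum, mul_left_comm]
      _ ≤ r ^ m * (r * f a) := by gcongr; exact hWf a
      _ = r ^ (m + 1) * f a := by ring

variable [DecidableEq α] {M : Matrix α α ℝ}

theorem pathExp_const (hM : M ∈ Matrix.rowStochastic ℝ α) (m : ℕ) (a : α) (c : ℝ) :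
    (pathExp M m a fun _ => c) = c := by
  induction m generalizing a with
  | zero => exact pathExp_zero M a _
  | succ m ih =>
    simp only [pathExp_succ, ih, ← Finset.sum_mul, Matrix.sum_row_of_mem_rowStochastic hM, one_mul]

theorem pathExp_succ_pathSum (hM : M ∈ Matrix.rowStochastic ℝ α) (q : α → ℝ) (m : ℕ) (a : α) :
    pathExp M (m + 1) a (pathSum fun i _ => q i) =
      q a + ∑ b, M a b * pathExp M m b (pathSum fun i _ => q i) := by
  simp only [pathExp_succ, pathSum_cons, pathExp_add, pathExp_const hM, mul_add,
    Finset.sum_add_distrib, ← Finset.sum_mul, Matrix.sum_row_of_mem_rowStochastic hM, one_mul]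

/-- The second moment of a martingale is the expectation of its predictable quadratic
variation. -/
theorem pathExp_sq_add_pathSum (hM : M ∈ Matrix.rowStochastic ℝ α) {g : α → α → ℝ} {q : α → ℝ}
    (hg : ∀ a, ∑ b, M a b * g a b = 0) (hq : ∀ a, ∑ b, M a b * g a b ^ 2 = q a)
    (m : ℕ) (a : α) (d : ℝ) :
    (pathExp M m a fun x => (d + pathSum g x) ^ 2) =
      d ^ 2 + pathExp M m a (pathSum fun i _ => q i) := by
  induction m generalizing a d with
  | zero => simp [pathExp_zero, pathSum]
  | succ m ih =>
    have step (b : α) : (pathExp M m b fun x => (d + pathSum g (Fin.cons a x)) ^ 2) =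
        (d + g a b) ^ 2 + pathExp M m b (pathSum fun i _ => q i) := by
      rw [← ih]
      exact pathExp_congr fun x hx => by rw [pathSum_cons, hx, add_assoc]
    have expand (b : α) : M a b * ((d + g a b) ^ 2 + pathExp M m b (pathSum fun i _ => q i)) =
        M a b * d ^ 2 + 2 * d * (M a b * g a b) + M a b * g a b ^ 2 +
          M a b * pathExp M m b (pathSum fun i _ => q i) := by ring
    simp only [pathExp_succ_pathSum hM, pathExp_succ M m a fun x => (d + pathSum g x) ^ 2, step,
      expand, Finset.sum_add_distrib, ← Finset.mul_sum, ← Finset.sum_mul, hg, hq,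
      Matrix.sum_row_of_mem_rowStochastic hM]
    ring

end PathSums

theorem row_mem_stdSimplex {α : Type*} [Fintype α] [DecidableEq α] {M : Matrix α α ℝ}
    (hM : M ∈ Matrix.rowStochastic ℝ α) (i : α) : M i ∈ stdSimplex ℝ α :=
  ⟨fun _ => Matrix.nonneg_of_mem_rowStochastic hM, Matrix.sum_row_of_mem_rowStochastic hM i⟩

theorem mem_rowStochastic_of_row_mem {α : Type*} [Fintype α] [DecidableEq α] {M : Matrix α α ℝ}
    (hM : ∀ i, M i ∈ stdSimplex ℝ α) : M ∈ Matrix.rowStochastic ℝ α :=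
  Matrix.mem_rowStochastic_iff_sum.2 ⟨fun i j => (hM i).1 j, fun i => (hM i).2⟩

theorem sum_mul_le_of_mem_stdSimplex {α : Type*} [Fintype α] {p f : α → ℝ} {b : ℝ}
    (hp : p ∈ stdSimplex ℝ α) (hf : ∀ i, f i ≤ b) : ∑ i, p i * f i ≤ b := by
  calc ∑ i, p i * f i ≤ ∑ i, p i * b :=
        Finset.sum_le_sum fun i _ => mul_le_mul_of_nonneg_left (hf i) (hp.1 i)
    _ = b := by rw [← Finset.sum_mul, hp.2, one_mul]

theorem le_sum_mul_of_mem_stdSimplex {α : Type*} [Fintype α] {p f : α → ℝ} {b : ℝ}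
    (hp : p ∈ stdSimplex ℝ α) (hf : ∀ i, b ≤ f i) : b ≤ ∑ i, p i * f i := by
  calc b = ∑ i, p i * b := by rw [← Finset.sum_mul, hp.2, one_mul]
    _ ≤ ∑ i, p i * f i :=
        Finset.sum_le_sum fun i _ => mul_le_mul_of_nonneg_left (hf i) (hp.1 i)

section Risk

variable {k n : ℕ}

theorem l2Loss_nonneg (p q : Fin k → ℝ) : 0 ≤ l2Loss p q :=
  Finset.sum_nonneg fun _ _ => sq_nonneg _

theorem l2Loss_le_two {p q : Fin k → ℝ} (hp : p ∈ stdSimplex ℝ (Fin k))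
    (hq : q ∈ stdSimplex ℝ (Fin k)) : l2Loss p q ≤ 2 := by
  have sq_le (j : Fin k) : (p j - q j) ^ 2 ≤ p j + q j := by
    have hpj := mem_Icc_of_mem_stdSimplex hp j
    have hqj := mem_Icc_of_mem_stdSimplex hq j
    nlinarith [mul_nonneg hpj.1 hqj.1, mul_nonneg hpj.1 (sub_nonneg.2 hpj.2),
      mul_nonneg hqj.1 (sub_nonneg.2 hqj.2)]
  calc l2Loss p q ≤ ∑ j, (p j + q j) := Finset.sum_le_sum fun j _ => sq_le j
    _ = 2 := by rw [Finset.sum_add_distrib, hp.2, hq.2]; norm_num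

namespace MarkovChain

theorem sum_pathProb_succ_mul (C : MarkovChain k) (m : ℕ) (F : (Fin (m + 1) → Fin k) → ℝ) :
    ∑ x, C.pathProb (m + 1) x * F x = ∑ a, C.init a * pathExp C.trans m a F := by
  simp only [sum_fin_succ_pi, pathProb, pathExp, pathWeight, Fin.cons_zero, Finset.mul_sum,
    mul_assoc]

theorem pathProb_mem_stdSimplex (C : MarkovChain k) (n : ℕ) :
    C.pathProb n ∈ stdSimplex ℝ (Fin n → Fin k) := by
  cases n with
  | zero => simp [pathProb, stdSimplex]
  | succ m =>
    refine ⟨fun x => mul_nonneg (C.init_mem.1 _)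
      (Finset.prod_nonneg fun _ _ => Matrix.nonneg_of_mem_rowStochastic C.trans_mem), ?_⟩
    have h := C.sum_pathProb_succ_mul m fun _ => 1
    simpa only [mul_one, pathExp_const C.trans_mem, C.init_mem.2] using h

theorem stat_apply (C : MarkovChain k) (j : Fin k) :
    C.stat j = ∑ i, C.stat i * C.trans i j :=
  (congrFun C.stat_vecMul j).symm

theorem le_stat (C : MarkovChain k) {j : Fin k} {b : ℝ} (h : ∀ i, b ≤ C.trans i j) :
    b ≤ C.stat j :=
  (le_sum_mul_of_mem_stdSimplex C.stat_mem h).trans_eq (C.stat_apply j).symm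

theorem stat_le (C : MarkovChain k) {j : Fin k} {b : ℝ} (h : ∀ i, C.trans i j ≤ b) :
    C.stat j ≤ b :=
  (C.stat_apply j).trans_le (sum_mul_le_of_mem_stdSimplex C.stat_mem h)

end MarkovChain

theorem stateRisk_nonneg (C : MarkovChain k) (E : TransitionEstimator k n) (i : Fin k) :
    0 ≤ stateRisk C E i :=
  le_sum_mul_of_mem_stdSimplex (C.pathProb_mem_stdSimplex n) fun _ => l2Loss_nonneg _ _

theorem stateRisk_le_two (C : MarkovChain k) (E : TransitionEstimator k n) (i : Fin k) :
    stateRisk C E i ≤ 2 :=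
  sum_mul_le_of_mem_stdSimplex (C.pathProb_mem_stdSimplex n) fun x =>
    l2Loss_le_two (row_mem_stdSimplex C.trans_mem i) (row_mem_stdSimplex (E x).2 i)

theorem stateRisk_le_worstStateRisk (C : MarkovChain k) (E : TransitionEstimator k n)
    (i : Fin k) : stateRisk C E i ≤ worstStateRisk C E :=
  le_ciSup (f := fun i => stateRisk C E i) (Set.finite_range _).bddAbove i

theorem worstStateRisk_nonneg (C : MarkovChain k) (E : TransitionEstimator k n) :
    0 ≤ worstStateRisk C E :=
  Real.iSup_nonneg fun i => stateRisk_nonneg C E i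

theorem worstStateRisk_le_two (C : MarkovChain k) (E : TransitionEstimator k n) :
    worstStateRisk C E ≤ 2 :=
  Real.iSup_le (fun i => stateRisk_le_two C E i) zero_le_two

theorem weightedRisk_nonneg (C : MarkovChain k) (E : TransitionEstimator k n) :
    0 ≤ weightedRisk C E :=
  le_sum_mul_of_mem_stdSimplex C.stat_mem fun i => stateRisk_nonneg C E i

theorem weightedRisk_le_worstStateRisk (C : MarkovChain k) (E : TransitionEstimator k n) :
    weightedRisk C E ≤ worstStateRisk C E :=
  sum_mul_le_of_mem_stdSimplex C.stat_mem fun i => stateRisk_le_worstStateRisk C E i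

end Risk

section Poisson

variable {α : Type*} [Fintype α]

/-- `g` solves the Poisson equation `(1 - M) g = h` of the transition matrix `M`. Adding the
increments `g(x (t + 1)) - g(x t)` turns the additive functional of `h` into a martingale. -/
def IsPoissonSolution (M : Matrix α α ℝ) (h g : α → ℝ) : Prop :=
  ∀ a, g a = h a + ∑ b, M a b * g b

theorem abs_sum_mul_le_mul_norm {w : α → ℝ} (hw : ∀ b, 0 ≤ w b) (g : α → ℝ) :
    |∑ b, w b * g b| ≤ (∑ b, w b) * ‖g‖ := by
  rw [Finset.sum_mul]
  refine (Finset.abs_sum_le_sum_abs _ _).trans (Finset.sum_le_sum fun b _ => ?_)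
  rw [abs_mul, abs_of_nonneg (hw b)]
  exact mul_le_mul_of_nonneg_left (norm_le_pi_norm g b) (hw b)

variable [DecidableEq α] {M : Matrix α α ℝ} {δ : ℝ} {p g h : α → ℝ}

theorem mul_norm_le_of_discounted_fixed_point (hM : M ∈ Matrix.rowStochastic ℝ α)
    (hp : p ∈ stdSimplex ℝ α) (hδ : ∀ a b, δ * p b ≤ M a b)
    (hg : ∀ a, g a = h a + ∑ b, (M a b - δ * p b) * g b) : δ * ‖g‖ ≤ ‖h‖ := by
  have : Nonempty α := by
    by_contra hα
    have := not_nonempty_iff.1 hα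
    simpa using hp.2
  have row_sum (a : α) : ∑ b, (M a b - δ * p b) = 1 - δ := by
    rw [Finset.sum_sub_distrib, ← Finset.mul_sum, hp.2, Matrix.sum_row_of_mem_rowStochastic hM,
      mul_one]
  have norm_le : ‖g‖ ≤ ‖h‖ + (1 - δ) * ‖g‖ := by
    refine (pi_norm_le_iff_of_nonempty _).2 fun a => ?_
    rw [hg a, ← row_sum a]
    exact (norm_add_le _ _).trans (add_le_add (norm_le_pi_norm h a)
      (abs_sum_mul_le_mul_norm (fun b => sub_nonneg.2 (hδ a b)) g))
  linarith

/-- Subtracting the Doeblin minorant `δ p` from every row makes the equation contractive; the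
solution found this way has `∑ b, p b * g b = 0`, so that it solves the original equation. -/
theorem exists_isPoissonSolution (hM : M ∈ Matrix.rowStochastic ℝ α) (hp : p ∈ stdSimplex ℝ α)
    (hpM : Matrix.vecMul p M = p) (hδ0 : 0 < δ) (hδ : ∀ a b, δ * p b ≤ M a b)
    (hph : ∑ a, p a * h a = 0) : ∃ g, IsPoissonSolution M h g ∧ δ * ‖g‖ ≤ ‖h‖ := by
  let T : (α → ℝ) →ₗ[ℝ] (α → ℝ) :=
    LinearMap.id - (Matrix.of fun a b => M a b - δ * p b).mulVecLin
  have T_apply (g : α → ℝ) (a : α) : T g a = g a - ∑ b, (M a b - δ * p b) * g b := rfl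
  have T_injective : Function.Injective T := by
    refine LinearMap.ker_eq_bot.1 (LinearMap.ker_eq_bot'.2 fun g hg => ?_)
    have : δ * ‖g‖ ≤ ‖(0 : α → ℝ)‖ := mul_norm_le_of_discounted_fixed_point hM hp hδ fun a => by
      rw [Pi.zero_apply, zero_add, ← sub_eq_zero, ← T_apply, hg, Pi.zero_apply]
    rw [norm_zero] at this
    exact norm_le_zero_iff.1 (nonpos_of_mul_nonpos_right this hδ0)
  obtain ⟨g, hg⟩ := LinearMap.injective_iff_surjective.1 T_injective h
  have fixed (a : α) : g a = h a + ∑ b, (M a b - δ * p b) * g b := by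
    rw [← hg, T_apply, sub_add_cancel]
  have split (a : α) : ∑ b, (M a b - δ * p b) * g b =
      ∑ b, M a b * g b - δ * ∑ b, p b * g b := by
    simp only [sub_mul, Finset.sum_sub_distrib, Finset.mul_sum, mul_assoc]
  have mean_M : ∑ a, p a * ∑ b, M a b * g b = ∑ b, p b * g b := by
    change p ⬝ᵥ M.mulVec g = p ⬝ᵥ g
    rw [Matrix.dotProduct_mulVec, hpM]
  have mean_zero : ∑ b, p b * g b = 0 := by
    have h1 : ∑ a, p a * g a = ∑ a, p a * (h a + (∑ b, M a b * g b - δ * ∑ b, p b * g b)) :=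
      Finset.sum_congr rfl fun a _ => by rw [← split, ← fixed]
    simp only [mul_add, mul_sub, Finset.sum_add_distrib, Finset.sum_sub_distrib, mean_M, hph,
      ← Finset.sum_mul, hp.2] at h1
    exact (mul_eq_zero.1 (by linarith : δ * ∑ b, p b * g b = 0)).resolve_left hδ0.ne'
  refine ⟨g, fun a => ?_, mul_norm_le_of_discounted_fixed_point hM hp hδ fixed⟩
  rw [fixed a, split, mean_zero, mul_zero, sub_zero]

end Poisson

section AdditiveFunctional

variable {α : Type*} [Fintype α] {f g : α → ℝ} {ϖ l : ℝ}

theorem sum_mul_exp_le {p : α → ℝ} (hp : p ∈ stdSimplex ℝ α) (hl : |l| * ‖g‖ ≤ 1) :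
    ∑ b, p b * Real.exp (l * g b) ≤ Real.exp (l * ∑ b, p b * g b + (|l| * ‖g‖) ^ 2) := by
  have exp_le (b : α) : Real.exp (l * g b) ≤ 1 + l * g b + (|l| * ‖g‖) ^ 2 := by
    have h1 : |l * g b| ≤ |l| * ‖g‖ := by
      rw [abs_mul]
      exact mul_le_mul_of_nonneg_left (norm_le_pi_norm g b) (abs_nonneg l)
    have h2 := le_of_abs_le (Real.abs_exp_sub_one_sub_id_le (h1.trans hl))
    have h3 : (l * g b) ^ 2 ≤ (|l| * ‖g‖) ^ 2 := by
      rw [← sq_abs]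
      exact pow_le_pow_left₀ (abs_nonneg _) h1 2
    linarith
  calc ∑ b, p b * Real.exp (l * g b) ≤ ∑ b, p b * (1 + l * g b + (|l| * ‖g‖) ^ 2) :=
        Finset.sum_le_sum fun b _ => mul_le_mul_of_nonneg_left (exp_le b) (hp.1 b)
    _ = l * ∑ b, p b * g b + (|l| * ‖g‖) ^ 2 + 1 := by
        simp only [mul_add, Finset.sum_add_distrib, ← Finset.sum_mul, hp.2, mul_left_comm _ l,
          ← Finset.mul_sum]
        ring
    _ ≤ _ := Real.add_one_le_exp _

variable [DecidableEq α] {M : Matrix α α ℝ}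

theorem pathExp_pathSum_le (hM : M ∈ Matrix.rowStochastic ℝ α)
    (hg : IsPoissonSolution M (fun a => f a - ϖ) g) (m : ℕ) (a : α) :
    pathExp M m a (pathSum fun b _ => f b) ≤ m * ϖ + 2 * ‖g‖ := by
  have abs_le (a : α) : |g a| ≤ ‖g‖ := norm_le_pi_norm g a
  have key : pathExp M m a (pathSum fun b _ => f b) ≤ m * ϖ + g a + ‖g‖ := by
    induction m generalizing a with
    | zero =>
      simp only [pathExp_zero, pathSum, Finset.univ_eq_empty, Finset.sum_empty, Nat.cast_zero]
      linarith [neg_le_of_abs_le (abs_le a)]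
    | succ m ih =>
      have h : ∑ b, M a b * pathExp M m b (pathSum fun b _ => f b) ≤
          ∑ b, M a b * (m * ϖ + g b + ‖g‖) := Finset.sum_le_sum fun b _ =>
        mul_le_mul_of_nonneg_left (ih b) (Matrix.nonneg_of_mem_rowStochastic hM)
      simp only [mul_add, Finset.sum_add_distrib, ← Finset.sum_mul,
        Matrix.sum_row_of_mem_rowStochastic hM] at h
      rw [pathExp_succ_pathSum hM]
      push_cast
      linarith [hg a]
  linarith [le_of_abs_le (abs_le a)]

theorem pathExp_exp_mul_pathSum_le (hM : M ∈ Matrix.rowStochastic ℝ α)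
    (hg : IsPoissonSolution M (fun a => f a - ϖ) g) (hl : |l| * ‖g‖ ≤ 1) (m : ℕ) (a : α) :
    (pathExp M m a fun x => Real.exp (l * pathSum (fun b _ => f b) x)) ≤
      Real.exp 2 * Real.exp (m * (l * ϖ + (|l| * ‖g‖) ^ 2)) := by
  set u : ℝ := |l| * ‖g‖
  let W : Matrix α α ℝ := .of fun b c => M b c * Real.exp (l * f b)
  have abs_le (b : α) : |l * g b| ≤ u := by
    rw [abs_mul]
    exact mul_le_mul_of_nonneg_left (norm_le_pi_norm g b) (abs_nonneg l)
  have tilt : (pathExp M m a fun x => Real.exp (l * pathSum (fun b _ => f b) x)) =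
      pathExp W m a fun _ => 1 := by
    rw [← pathExp_exp_pathSum]
    simp only [pathSum, Finset.mul_sum]
  have supersolution (b : α) : ∑ c, W b c * Real.exp (u + l * g c) ≤
      Real.exp (l * ϖ + u ^ 2) * Real.exp (u + l * g b) :=
    calc ∑ c, W b c * Real.exp (u + l * g c)
        = Real.exp (l * f b + u) * ∑ c, M b c * Real.exp (l * g c) := by
          rw [Finset.mul_sum]
          refine Finset.sum_congr rfl fun c _ => ?_
          simp only [W, Matrix.of_apply, Real.exp_add]
          ring
      _ ≤ Real.exp (l * f b + u) * Real.exp (l * ∑ c, M b c * g c + u ^ 2) :=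
          mul_le_mul_of_nonneg_left (sum_mul_exp_le (row_mem_stdSimplex hM b) hl)
            (Real.exp_pos _).le
      _ = Real.exp (l * ϖ + u ^ 2) * Real.exp (u + l * g b) := by
          rw [← Real.exp_add, ← Real.exp_add, hg b]
          ring_nf
  calc _ = pathExp W m a fun _ => 1 := tilt
    _ ≤ Real.exp (l * ϖ + u ^ 2) ^ m * Real.exp (u + l * g a) :=
        pathExp_one_le_pow_mul (f := fun b => Real.exp (u + l * g b))
          (fun b c => mul_nonneg (Matrix.nonneg_of_mem_rowStochastic hM) (Real.exp_pos _).le)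
          (Real.exp_pos _).le
          (fun b => Real.one_le_exp (by linarith [neg_le_of_abs_le (abs_le b)])) supersolution m a
    _ ≤ Real.exp 2 * Real.exp (m * (l * ϖ + u ^ 2)) := by
        rw [← Real.exp_nat_mul, mul_comm]
        gcongr
        linarith [le_of_abs_le (abs_le a)]

end AdditiveFunctional

section Empirical

variable {k m : ℕ} {M : Matrix (Fin k) (Fin k) ℝ}

/-- The number of visits to `i` before the last state of a path. -/
def visitCount (i : Fin k) (x : Fin (m + 1) → Fin k) : ℝ :=
  pathSum (fun b _ => if b = i then 1 else 0) x

/-- The number of transitions from `i` to `j` along a path. -/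
def transCount (i j : Fin k) (x : Fin (m + 1) → Fin k) : ℝ :=
  pathSum (fun b c => if b = i ∧ c = j then 1 else 0) x

/-- The empirical frequencies of the transitions out of `i`. A state without observed transition
is given the point mass at itself, so that the row is always a distribution. -/
noncomputable def empiricalRow (i : Fin k) (x : Fin (m + 1) → Fin k) : Fin k → ℝ :=
  if visitCount i x = 0 then Pi.single i 1 else fun j => transCount i j x / visitCount i x

theorem visitCount_nonneg (i : Fin k) (x : Fin (m + 1) → Fin k) : 0 ≤ visitCount i x :=
  pathSum_nonneg (fun _ _ => by positivity) x

theorem sum_transCount (i : Fin k) (x : Fin (m + 1) → Fin k) :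
    ∑ j, transCount i j x = visitCount i x := by
  simp only [transCount, visitCount, pathSum]
  rw [Finset.sum_comm]
  simp only [ite_and, Finset.sum_ite_irrel, Finset.sum_ite_eq, Finset.mem_univ, if_true,
    Finset.sum_const_zero]

theorem empiricalRow_mem_stdSimplex (i : Fin k) (x : Fin (m + 1) → Fin k) :
    empiricalRow i x ∈ stdSimplex ℝ (Fin k) := by
  unfold empiricalRow
  split_ifs with h
  · exact single_mem_stdSimplex ℝ i
  · refine ⟨fun j => div_nonneg (pathSum_nonneg (fun _ _ => ?_) x) (visitCount_nonneg i x), ?_⟩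
    · positivity
    · rw [← Finset.sum_div, sum_transCount, div_self h]

/-- The empirical estimator of the transition matrix. A sample of length `0` is mapped to the
identity matrix. -/
noncomputable def empiricalEstimator (k : ℕ) : (n : ℕ) → TransitionEstimator k n
  | 0 => fun _ => 1
  | _ + 1 => fun x => ⟨fun i => empiricalRow i x,
      mem_rowStochastic_of_row_mem fun i => empiricalRow_mem_stdSimplex i x⟩

/-- With at least `t` visits the loss is governed by the numerators `N_ij - M_ij N_i`; the event of
fewer visits is charged with the Chernoff weight `exp (l * (t - N_i)) ≥ 1`. -/
theorem l2Loss_empiricalRow_le {p : Fin k → ℝ} (hp : p ∈ stdSimplex ℝ (Fin k)) (i : Fin k)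
    (x : Fin (m + 1) → Fin k) {t l : ℝ} (ht : 0 < t) (hl : 0 ≤ l) :
    l2Loss p (empiricalRow i x) ≤
      1 / t ^ 2 * ∑ j, (transCount i j x - p j * visitCount i x) ^ 2 +
        2 * Real.exp (l * t) * Real.exp (-l * visitCount i x) := by
  have sum_nonneg : 0 ≤ ∑ j, (transCount i j x - p j * visitCount i x) ^ 2 :=
    Finset.sum_nonneg fun _ _ => sq_nonneg _
  rcases le_or_gt t (visitCount i x) with h | h
  · have hN : 0 < visitCount i x := ht.trans_le h
    have loss_eq : l2Loss p (empiricalRow i x) =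
        1 / visitCount i x ^ 2 * ∑ j, (transCount i j x - p j * visitCount i x) ^ 2 := by
      unfold l2Loss empiricalRow
      rw [if_neg hN.ne', Finset.mul_sum]
      refine Finset.sum_congr rfl fun j _ => ?_
      field_simp
      ring
    rw [loss_eq]
    exact (mul_le_mul_of_nonneg_right (by gcongr) sum_nonneg).trans
      (le_add_of_nonneg_right (by positivity))
  · have one_le : 1 ≤ Real.exp (l * t) * Real.exp (-l * visitCount i x) := by
      rw [← Real.exp_add]
      exact Real.one_le_exp (by nlinarith)
    have := l2Loss_le_two hp (empiricalRow_mem_stdSimplex i x)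
    have : 0 ≤ 1 / t ^ 2 * ∑ j, (transCount i j x - p j * visitCount i x) ^ 2 := by positivity
    linarith

theorem pathExp_sq_transCount_sub (hM : M ∈ Matrix.rowStochastic ℝ (Fin k)) (i j a : Fin k) :
    (pathExp M m a fun x => (transCount i j x - M i j * visitCount i x) ^ 2) =
      M i j * (1 - M i j) * pathExp M m a (visitCount i) := by
  let g : Fin k → Fin k → ℝ := fun b c => if b = i then (if c = j then 1 else 0) - M i j else 0
  have eq_pathSum (x : Fin (m + 1) → Fin k) :
      transCount i j x - M i j * visitCount i x = 0 + pathSum g x := by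
    simp only [transCount, visitCount, pathSum, g, Finset.mul_sum, ← Finset.sum_sub_distrib,
      zero_add]
    refine Finset.sum_congr rfl fun t _ => ?_
    by_cases hb : x t.castSucc = i <;> simp [hb]
  have mean_zero (b : Fin k) : ∑ c, M b c * g b c = 0 := by
    by_cases hb : b = i
    · simp [g, hb, mul_sub, ← Finset.sum_mul, Matrix.sum_row_of_mem_rowStochastic hM]
    · simp [g, hb]
  have variance (b : Fin k) :
      ∑ c, M b c * g b c ^ 2 = M i j * (1 - M i j) * if b = i then 1 else 0 := by
    by_cases hb : b = i
    · have expand (c : Fin k) : M i c * ((if c = j then 1 else 0) - M i j) ^ 2 =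
          (if c = j then M i c * (1 - 2 * M i j) else 0) + M i c * M i j ^ 2 := by
        split_ifs <;> ring
      simp only [g, hb, if_true, expand, Finset.sum_add_distrib, Finset.sum_ite_eq',
        Finset.mem_univ, ← Finset.sum_mul, Matrix.sum_row_of_mem_rowStochastic hM]
      ring
    · simp [g, hb]
  simp only [eq_pathSum, pathExp_sq_add_pathSum hM mean_zero variance]
  rw [← pathExp_const_mul, zero_pow two_ne_zero, zero_add]
  exact pathExp_congr fun x _ => by simp only [visitCount, pathSum, Finset.mul_sum]

theorem sum_mul_one_sub_le {α : Type*} [Fintype α] {p : α → ℝ} (hp : p ∈ stdSimplex ℝ α) :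
    ∑ j, p j * (1 - p j) ≤ 1 - 1 / (Fintype.card α : ℝ) := by
  have h : 1 ≤ Fintype.card α * ∑ j, p j ^ 2 := by
    simpa only [hp.2, one_pow, Finset.card_univ] using
      sq_sum_le_card_mul_sum_sq (s := Finset.univ) (f := p)
  have expand : ∑ j, p j * (1 - p j) = 1 - ∑ j, p j ^ 2 := by
    simp only [mul_sub, mul_one, Finset.sum_sub_distrib, hp.2, sq]
  rw [expand]
  exact sub_le_sub_left (div_le_of_le_mul₀ (Nat.cast_nonneg _)
    (Finset.sum_nonneg fun _ _ => sq_nonneg _) (by linarith)) 1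

theorem pathExp_l2Loss_empiricalRow_le (hM : M ∈ Matrix.rowStochastic ℝ (Fin k)) (i a : Fin k)
    {t l : ℝ} (ht : 0 < t) (hl : 0 ≤ l) :
    (pathExp M m a fun x => l2Loss (M i) (empiricalRow i x)) ≤
      1 / t ^ 2 * ((1 - 1 / (k : ℝ)) * pathExp M m a (visitCount i)) +
        2 * Real.exp (l * t) * pathExp M m a fun x => Real.exp (-l * visitCount i x) := by
  have hM0 (b c : Fin k) : 0 ≤ M b c := Matrix.nonneg_of_mem_rowStochastic hM
  have visit_nonneg : 0 ≤ pathExp M m a (visitCount i) := Finset.sum_nonneg fun _ _ =>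
    mul_nonneg (pathWeight_nonneg hM0 _) (visitCount_nonneg i _)
  refine (pathExp_mono hM0 a fun x =>
    l2Loss_empiricalRow_le (row_mem_stdSimplex hM i) i x ht hl).trans ?_
  simp only [pathExp_add, pathExp_const_mul, pathExp_sum, pathExp_sq_transCount_sub hM,
    ← Finset.sum_mul]
  have := sum_mul_one_sub_le (row_mem_stdSimplex hM i)
  rw [Fintype.card_fin] at this
  gcongr

namespace MarkovChain

variable {C : MarkovChain k} {δ ε : ℝ}

theorem exists_isPoissonSolution_indicator (hδ : 0 < δ) (hC : C ∈ lowerBounded k δ) (i : Fin k) :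
    ∃ g, IsPoissonSolution C.trans (fun a => (if a = i then 1 else 0) - C.stat i) g ∧
      ‖g‖ ≤ 1 / δ := by
  have hstat := mem_Icc_of_mem_stdSimplex C.stat_mem
  obtain ⟨g, hg, hgδ⟩ := exists_isPoissonSolution C.trans_mem C.stat_mem C.stat_vecMul hδ
    (h := fun a => (if a = i then 1 else 0) - C.stat i)
    (fun a b => (mul_le_of_le_one_right hδ.le (hstat b).2).trans (hC a b))
    (by simp [mul_sub, ← Finset.sum_mul, C.stat_mem.2])
  refine ⟨g, hg, (le_div_iff₀' hδ).2 (hgδ.trans ?_)⟩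
  refine (pi_norm_le_iff_of_nonneg zero_le_one).2 fun a => abs_le.2 ?_
  constructor <;> split_ifs <;> linarith [(hstat i).1, (hstat i).2]

/-- The tilt `l = ε δ³ / 2` is admissible because the Poisson solution is bounded by `1 / δ`. -/
theorem exp_mul_pathExp_exp_neg_visitCount_le (hδ : 0 < δ) (hε : 0 < ε) (hε1 : ε < 1)
    (hC : C ∈ lowerBounded k δ) (i a : Fin k) :
    Real.exp (ε * δ ^ 3 / 2 * ((1 - ε) * m * C.stat i)) *
        (pathExp C.trans m a fun x => Real.exp (-(ε * δ ^ 3 / 2) * visitCount i x)) ≤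
      Real.exp 2 * Real.exp (-(ε ^ 2 * δ ^ 4 / 4) * m) := by
  obtain ⟨g, hg, hgδ⟩ := exists_isPoissonSolution_indicator hδ hC i
  have δ_le_stat : δ ≤ C.stat i := C.le_stat fun a => hC a i
  have δ_le_one : δ ≤ 1 := δ_le_stat.trans (mem_Icc_of_mem_stdSimplex C.stat_mem i).2
  set l : ℝ := ε * δ ^ 3 / 2 with hl
  have l_norm_g : |-l| * ‖g‖ ≤ ε * δ ^ 2 / 2 := by
    rw [abs_neg, abs_of_nonneg (by positivity)]
    calc l * ‖g‖ ≤ l * (1 / δ) := by gcongr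
      _ = ε * δ ^ 2 / 2 := by rw [hl]; field_simp
  have l_small : |-l| * ‖g‖ ≤ 1 := l_norm_g.trans <| by
    nlinarith [pow_le_one₀ hδ.le δ_le_one (n := 2)]
  have drift_ge : ε ^ 2 * δ ^ 4 / 2 ≤ l * ε * C.stat i :=
    calc ε ^ 2 * δ ^ 4 / 2 = l * ε * δ := by rw [hl]; ring
      _ ≤ l * ε * C.stat i := by gcongr
  have square_le := pow_le_pow_left₀ (by positivity) l_norm_g 2
  calc _ ≤ Real.exp (l * ((1 - ε) * m * C.stat i)) *
        (Real.exp 2 * Real.exp (m * (-l * C.stat i + (|-l| * ‖g‖) ^ 2))) := by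
        gcongr
        exact pathExp_exp_mul_pathSum_le C.trans_mem hg l_small m a
    _ = Real.exp 2 * Real.exp (m * ((|-l| * ‖g‖) ^ 2 - l * ε * C.stat i)) := by
        rw [mul_left_comm, ← Real.exp_add]
        ring_nf
    _ ≤ _ := by
        rw [mul_comm (-_) (m : ℝ)]
        gcongr
        linarith

end MarkovChain

theorem stateRisk_empiricalEstimator_le {δ ε : ℝ} (hδ : 0 < δ) (hε : 0 < ε) (hε1 : ε < 1)
    {C : MarkovChain k} (hC : C ∈ MarkovChain.lowerBounded k δ) (i : Fin k) (hm : 0 < m) :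
    stateRisk C (empiricalEstimator k (m + 1)) i ≤
      1 / ((1 - ε) * m * C.stat i) ^ 2 * ((1 - 1 / (k : ℝ)) * (m * C.stat i + 2 / δ)) +
        2 * (Real.exp 2 * Real.exp (-(ε ^ 2 * δ ^ 4 / 4) * m)) := by
  obtain ⟨g, hg, hgδ⟩ := MarkovChain.exists_isPoissonSolution_indicator hδ hC i
  have stat_pos : 0 < C.stat i := hδ.trans_le (C.le_stat fun a => hC a i)
  have threshold_pos : 0 < (1 - ε) * m * C.stat i :=
    mul_pos (mul_pos (by linarith) (by exact_mod_cast hm)) stat_pos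
  have one_sub_nonneg : 0 ≤ 1 - 1 / (k : ℝ) := sub_nonneg.2 <|
    div_le_one_of_le₀ (by exact_mod_cast Fin.pos i) (Nat.cast_nonneg k)
  calc _ = ∑ a, C.init a * pathExp C.trans m a fun x => l2Loss (C.trans i) (empiricalRow i x) :=
        C.sum_pathProb_succ_mul m _
    _ ≤ _ := sum_mul_le_of_mem_stdSimplex C.init_mem fun a => by
        refine (pathExp_l2Loss_empiricalRow_le C.trans_mem i a threshold_pos
          (l := ε * δ ^ 3 / 2) (by positivity)).trans (add_le_add ?_ ?_)
        · have visits : pathExp C.trans m a (visitCount i) ≤ m * C.stat i + 2 * ‖g‖ :=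
            pathExp_pathSum_le C.trans_mem hg m a
          gcongr
          exact visits.trans (by linarith [div_eq_mul_one_div 2 δ])
        · rw [mul_assoc]
          exact mul_le_mul_of_nonneg_left
            (MarkovChain.exp_mul_pathExp_exp_neg_visitCount_le hδ hε hε1 hC i a) zero_le_two

end Empirical

section Asymptotics

theorem asympLE_of_eventually_le {a b : ℕ → ℝ} (h : ∀ᶠ n in atTop, a n ≤ b n) : AsympLE a b :=
  ⟨fun _ => 0, tendsto_const_nhds, by simpa only [add_zero, mul_one] using h⟩

theorem asympLE_of_forall_eventually_le {a b : ℕ → ℝ} (hb : ∀ᶠ n in atTop, 0 < b n)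
    (h : ∀ ε > 0, ∀ᶠ n in atTop, a n ≤ (1 + ε) * b n) : AsympLE a b := by
  refine ⟨fun n => max (a n / b n - 1) 0, ?_, ?_⟩
  · refine Metric.tendsto_nhds.2 fun ε hε => ?_
    filter_upwards [h (ε / 2) (half_pos hε), hb] with n hn hbn
    rw [Real.dist_0_eq_abs, abs_of_nonneg (le_max_right _ _)]
    have : a n / b n ≤ 1 + ε / 2 := (div_le_iff₀ hbn).2 hn
    exact max_lt (by linarith) hε
  · filter_upwards [hb] with n hbn
    rw [mul_comm, ← div_le_iff₀ hbn]
    linarith [le_max_left (a n / b n - 1) 0]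

theorem tendsto_succ_mul_add_div_sq {c : ℝ} (hc : c ≠ 0) (d : ℝ) :
    Tendsto (fun m : ℕ => ((m : ℝ) + 1) * (m + d) / (c * m) ^ 2) atTop (𝓝 (1 / c ^ 2)) := by
  have inv_tendsto := tendsto_inv_atTop_nhds_zero_nat (𝕜 := ℝ)
  have h : Tendsto (fun m : ℕ => (1 + (m : ℝ)⁻¹) * (1 + d * (m : ℝ)⁻¹) * (1 / c ^ 2)) atTop
      (𝓝 ((1 + 0) * (1 + d * 0) * (1 / c ^ 2))) :=
    ((inv_tendsto.const_add 1).mul ((inv_tendsto.const_mul d).const_add 1)).mul_const _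
  simp only [add_zero, mul_zero, one_mul] at h
  refine h.congr' ?_
  filter_upwards [eventually_ne_atTop 0] with m hm
  have : (m : ℝ) ≠ 0 := Nat.cast_ne_zero.2 hm
  field_simp

theorem tendsto_succ_mul_exp_neg {c : ℝ} (hc : 0 < c) :
    Tendsto (fun m : ℕ => ((m : ℝ) + 1) * Real.exp (-c * m)) atTop (𝓝 0) := by
  have mul_tendsto : Tendsto (fun m : ℕ => c * (m : ℝ)) atTop atTop :=
    tendsto_natCast_atTop_atTop.const_mul_atTop hc
  have h0 := (Real.tendsto_pow_mul_exp_neg_atTop_nhds_zero 0).comp mul_tendsto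
  have h1 := (Real.tendsto_pow_mul_exp_neg_atTop_nhds_zero 1).comp mul_tendsto
  have h := (h1.const_mul c⁻¹).add h0
  simp only [add_zero, mul_zero] at h
  refine h.congr fun m => ?_
  simp only [Function.comp_apply, pow_one, pow_zero, one_mul, neg_mul]
  field_simp

end Asymptotics

section Minimax

variable {ι κ : Type*} {R : ι → κ → ℝ} {b : ℝ}

theorem ciInf_ciSup_le (hR : ∀ e c, 0 ≤ R e c) (hb : 0 ≤ b) (e : ι) (h : ∀ c, R e c ≤ b) :
    ⨅ e, ⨆ c, R e c ≤ b :=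
  (ciInf_le ⟨0, Set.forall_mem_range.2 fun e => Real.iSup_nonneg (hR e)⟩ e).trans
    (Real.iSup_le h hb)

open scoped BigOperators in
theorem le_ciInf_ciSup_of_le_expect {Θ : Type*} [Fintype Θ] [Nonempty Θ] [Nonempty ι]
    (hR : ∀ e, BddAbove (Set.range (R e))) (C : Θ → κ) (h : ∀ e, b ≤ 𝔼 θ, R e (C θ)) :
    b ≤ ⨅ e, ⨆ c, R e c :=
  le_ciInf fun e => (h e).trans <|
    Finset.expect_le Finset.univ_nonempty fun θ _ => le_ciSup (hR e) (C θ)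

end Minimax

section UpperBounds

variable {k : ℕ} {δ : ℝ}

theorem stateRisk_empiricalEstimator_le_mul (hk : 2 ≤ k) {ε : ℝ} (hδ : 0 < δ) (hε : 0 < ε)
    (hε1 : ε < 1) {C : MarkovChain k} (hC : C ∈ MarkovChain.lowerBounded k δ) (i : Fin k) {m : ℕ}
    (hm : 0 < m) :
    stateRisk C (empiricalEstimator k (m + 1)) i ≤
      (((m : ℝ) + 1) * (m + 2 / δ ^ 2) / ((1 - ε) * m) ^ 2 +
        2 * Real.exp 2 / (1 - 1 / (k : ℝ)) *
          ((m + 1) * Real.exp (-(ε ^ 2 * δ ^ 4 / 4) * m))) *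
        ((1 - 1 / (k : ℝ)) / ((m + 1) * C.stat i)) := by
  have δ_le_stat : δ ≤ C.stat i := C.le_stat fun a => hC a i
  have stat_pos : 0 < C.stat i := hδ.trans_le δ_le_stat
  have stat_le_one : C.stat i ≤ 1 := (mem_Icc_of_mem_stdSimplex C.stat_mem i).2
  have one_sub_ε : 0 < 1 - ε := by linarith
  have one_sub_inv : 0 < 1 - 1 / (k : ℝ) :=
    sub_pos.2 ((div_lt_one (by positivity)).2 (by exact_mod_cast hk))
  refine (stateRisk_empiricalEstimator_le hδ hε hε1 hC i hm).trans ?_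
  rw [add_mul]
  set A := 1 - 1 / (k : ℝ)
  refine add_le_add ?_ ?_
  · calc 1 / ((1 - ε) * m * C.stat i) ^ 2 * (A * (m * C.stat i + 2 / δ))
        = (m + 1) * (m + 2 / (δ * C.stat i)) / ((1 - ε) * m) ^ 2 *
            (A / ((m + 1) * C.stat i)) := by
          field_simp
      _ ≤ (m + 1) * (m + 2 / δ ^ 2) / ((1 - ε) * m) ^ 2 * (A / ((m + 1) * C.stat i)) := by
          rw [sq δ]
          gcongr
  · calc 2 * (Real.exp 2 * Real.exp (-(ε ^ 2 * δ ^ 4 / 4) * m))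
        ≤ 2 * (Real.exp 2 * Real.exp (-(ε ^ 2 * δ ^ 4 / 4) * m)) / C.stat i :=
          le_div_self (by positivity) stat_pos stat_le_one
      _ = 2 * Real.exp 2 / A * ((m + 1) * Real.exp (-(ε ^ 2 * δ ^ 4 / 4) * m)) *
            (A / ((m + 1) * C.stat i)) := by
          field_simp

theorem eventually_stateRisk_empiricalEstimator_le (hk : 2 ≤ k) {η : ℝ} (hδ : 0 < δ)
    (hη : 0 < η) : ∀ᶠ n : ℕ in atTop, ∀ C ∈ MarkovChain.lowerBounded k δ, ∀ i,
      stateRisk C (empiricalEstimator k n) i ≤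
        (1 + η) * ((1 - 1 / (k : ℝ)) / (n * C.stat i)) := by
  obtain ⟨ε, hεη, hε⟩ : ∃ ε : ℝ, 1 / (1 - ε) ^ 2 < 1 + η ∧ ε ∈ Set.Ioo (0 : ℝ) 1 := by
    have hc : ContinuousAt (fun ε : ℝ => 1 / (1 - ε) ^ 2) 0 :=
      continuousAt_const.div (by fun_prop) (by norm_num)
    have h : ∀ᶠ ε in 𝓝[>] (0 : ℝ), 1 / (1 - ε) ^ 2 < 1 + η :=
      (hc.eventually_lt continuousAt_const (by norm_num [hη])).filter_mono nhdsWithin_le_nhds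
    exact (h.and (Ioo_mem_nhdsGT one_pos)).exists
  have factor_tendsto := (tendsto_succ_mul_add_div_sq (sub_pos.2 hε.2).ne' (2 / δ ^ 2)).add
    ((tendsto_succ_mul_exp_neg (c := ε ^ 2 * δ ^ 4 / 4) (by have := hε.1; positivity)).const_mul
      (2 * Real.exp 2 / (1 - 1 / (k : ℝ))))
  rw [mul_zero, add_zero] at factor_tendsto
  rw [← map_add_atTop_eq_nat 1, eventually_map]
  filter_upwards [factor_tendsto.eventually (eventually_lt_nhds hεη), eventually_gt_atTop 0]
    with m factor_lt hm C hC i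
  refine (stateRisk_empiricalEstimator_le_mul hk hδ hε.1 hε.2 hC i hm).trans ?_
  rw [Nat.cast_succ]
  have : 0 ≤ 1 - 1 / (k : ℝ) :=
    sub_nonneg.2 (div_le_one_of_le₀ (by exact_mod_cast Fin.pos i) (Nat.cast_nonneg k))
  have := C.stat_mem.1 i
  gcongr

variable {𝓜 : Set (MarkovChain k)}

theorem minimaxWeightedRisk_asympLE (hk : 2 ≤ k) (hδ : 0 < δ)
    (h𝓜 : 𝓜 ⊆ MarkovChain.lowerBounded k δ) :
    AsympLE (minimaxWeightedRisk 𝓜) fun n => ((k : ℝ) - 1) / (n : ℝ) := by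
  have hk' : (0 : ℝ) < k - 1 := sub_pos.2 (by exact_mod_cast hk)
  refine asympLE_of_forall_eventually_le ?_ fun ε hε => ?_
  · filter_upwards [eventually_gt_atTop 0] with n hn using div_pos hk' (Nat.cast_pos.2 hn)
  filter_upwards [eventually_stateRisk_empiricalEstimator_le hk hδ hε] with n hn
  refine ciInf_ciSup_le (fun E C => weightedRisk_nonneg C.1 E) (by positivity)
    (empiricalEstimator k n) fun C => ?_
  have stat_pos (i : Fin k) : 0 < C.1.stat i := hδ.trans_le (C.1.le_stat fun a => h𝓜 C.2 a i)
  calc weightedRisk C.1 (empiricalEstimator k n)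
      ≤ ∑ i, C.1.stat i * ((1 + ε) * ((1 - 1 / (k : ℝ)) / (n * C.1.stat i))) :=
        Finset.sum_le_sum fun i _ => mul_le_mul_of_nonneg_left (hn C.1 (h𝓜 C.2) i) (stat_pos i).le
    _ = ∑ i : Fin k, (1 + ε) * ((1 - 1 / (k : ℝ)) / n) :=
        Finset.sum_congr rfl fun i _ => by have := stat_pos i; field_simp
    _ = (1 + ε) * (((k : ℝ) - 1) / n) := by
        rw [Finset.sum_const, Finset.card_univ, Fintype.card_fin, nsmul_eq_mul]
        field_simp

theorem minimaxWorstStateRisk_asympLE (hk : 2 ≤ k) (hδ : 0 < δ)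
    (h𝓜 : 𝓜 ⊆ MarkovChain.lowerBounded k δ) {pmin : ℝ} (hp : 0 < pmin)
    (hstat : ∀ C ∈ 𝓜, ∀ i, pmin ≤ C.stat i) :
    AsympLE (minimaxWorstStateRisk 𝓜) fun n => (1 - 1 / (k : ℝ)) / ((n : ℝ) * pmin) := by
  have one_sub_inv : 0 < 1 - 1 / (k : ℝ) :=
    sub_pos.2 ((div_lt_one (by positivity)).2 (by exact_mod_cast hk))
  refine asympLE_of_forall_eventually_le ?_ fun ε hε => ?_
  · filter_upwards [eventually_gt_atTop 0] with n hn
    positivity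
  filter_upwards [eventually_stateRisk_empiricalEstimator_le hk hδ hε, eventually_gt_atTop 0]
    with n hn hn0
  refine ciInf_ciSup_le (fun E C => worstStateRisk_nonneg C.1 E) (by positivity)
    (empiricalEstimator k n) fun C => ?_
  refine Real.iSup_le (fun i => (hn C.1 (h𝓜 C.2) i).trans ?_) (by positivity)
  have := hstat C.1 C.2 i
  gcongr

end UpperBounds

section VanTrees

variable {X : Type*} {L : ℕ}

/-- The forward difference of the family `p` along the grid `0, …, L`, with the boundary terms
dropped. It plays the role of the derivative of the joint density in the van Trees inequality,
for which the prior must vanish at the boundary. -/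
def gridScore (p : Fin (L + 1) → X → ℝ) (m : Fin (L + 1)) (x : X) : ℝ :=
  Fin.lastCases (motive := fun _ => ℝ) 0 (fun t => p t.succ x) m - if m = 0 then 0 else p m x

variable {p : Fin (L + 1) → X → ℝ}

theorem sum_mul_gridScore (f : Fin (L + 1) → X → ℝ) (x : X) :
    ∑ m, f m x * gridScore p m x = ∑ t : Fin L, (f t.castSucc x - f t.succ x) * p t.succ x := by
  simp only [gridScore, mul_sub, sub_mul, Finset.sum_sub_distrib]
  rw [Fin.sum_univ_castSucc, Fin.sum_univ_succ (n := L)]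
  simp

variable [Fintype X]

/-- The chi-square divergence of `q` from `p`. -/
noncomputable def chiSqDiv (q p : X → ℝ) : ℝ := ∑ x, (q x - p x) ^ 2 / p x

theorem chiSqDiv_nonneg {p : X → ℝ} (hp : ∀ x, 0 < p x) (q : X → ℝ) : 0 ≤ chiSqDiv q p :=
  Finset.sum_nonneg fun x _ => div_nonneg (sq_nonneg _) (hp x).le

theorem sum_sub_mul_sq_div {p q : X → ℝ} (hp : ∀ x, 0 < p x) (hp1 : ∑ x, p x = 1)
    (hq1 : ∑ x, q x = 1) (e : ℝ) :
    ∑ x, (q x - e * p x) ^ 2 / p x = chiSqDiv q p + (1 - e) ^ 2 := by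
  have expand (x : X) : (q x - e * p x) ^ 2 / p x =
      (q x - p x) ^ 2 / p x + (2 * (1 - e) * q x - (1 - e ^ 2) * p x) := by
    have := (hp x).ne'
    field_simp
    ring
  simp only [expand, Finset.sum_add_distrib, Finset.sum_sub_distrib, ← Finset.mul_sum, hp1, hq1,
    chiSqDiv]
  ring

theorem sum_sq_div_eq_one_add_chiSqDiv {p q : X → ℝ} (hp : ∀ x, 0 < p x) (hp1 : ∑ x, p x = 1)
    (hq1 : ∑ x, q x = 1) : ∑ x, q x ^ 2 / p x = 1 + chiSqDiv q p := by
  simpa [add_comm] using sum_sub_mul_sq_div hp hp1 hq1 0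

theorem chiSqDiv_le_mul_sum_sq_div {p c : X → ℝ} {B : ℝ} (hc : ∀ x, 0 < c x) (hB : 0 < B)
    (h : ∀ x, c x ≤ B * p x) (q : X → ℝ) :
    chiSqDiv q p ≤ B * ∑ x, (q x - p x) ^ 2 / c x := by
  rw [Finset.mul_sum]
  refine Finset.sum_le_sum fun x _ => ?_
  have c_pos := hc x
  calc (q x - p x) ^ 2 / p x ≤ (q x - p x) ^ 2 / (c x / B) := by
        gcongr
        exact (div_le_iff₀' hB).2 (h x)
    _ = B * ((q x - p x) ^ 2 / c x) := by field_simp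

theorem sum_sum_sub_mul_gridScore (hsum : ∀ m, ∑ x, p m x = 1) (T : X → ℝ)
    (g : Fin (L + 1) → ℝ) :
    ∑ m, ∑ x, (T x - g m) * gridScore p m x = g (Fin.last L) - g 0 := by
  have telescope : ∑ t : Fin L, (g t.succ - g t.castSucc) = g (Fin.last L) - g 0 := by
    rw [Finset.sum_sub_distrib]
    linarith [Fin.sum_univ_castSucc g, Fin.sum_univ_succ g]
  rw [Finset.sum_comm, Finset.sum_congr rfl fun x _ => sum_mul_gridScore (fun m x => T x - g m) x,
    Finset.sum_comm, ← telescope]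
  simp only [sub_sub_sub_cancel_left, ← Finset.mul_sum, hsum, mul_one]

theorem sum_sum_gridScore_sq_div_le (hp : ∀ m x, 0 < p m x) (hsum : ∀ m, ∑ x, p m x = 1) :
    ∑ m, ∑ x, gridScore p m x ^ 2 / p m x ≤
      2 + ∑ t : Fin L, chiSqDiv (p t.succ) (p t.castSucc) := by
  set e : Fin (L + 1) → ℝ := fun m => if m = 0 then 0 else 1 with he
  have interior (t : Fin L) : ∑ x, gridScore p t.castSucc x ^ 2 / p t.castSucc x =
      chiSqDiv (p t.succ) (p t.castSucc) + (1 - e t.castSucc) ^ 2 := by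
    rw [← sum_sub_mul_sq_div (hp _) (hsum _) (hsum _)]
    simp [gridScore, he]
  have boundary : ∑ x, gridScore p (Fin.last L) x ^ 2 / p (Fin.last L) x ≤ 1 := by
    rw [← hsum (Fin.last L)]
    refine Finset.sum_le_sum fun x _ => ?_
    have := hp (Fin.last L) x
    rw [div_le_iff₀ this, gridScore, Fin.lastCases_last]
    split_ifs <;> nlinarith
  have sum_le_one : ∑ t : Fin L, (1 - e t.castSucc) ^ 2 ≤ 1 := by
    cases L with
    | zero => simp
    | succ L => simp [Fin.sum_univ_succ, he]
  rw [Fin.sum_univ_castSucc]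
  simp only [interior, Finset.sum_add_distrib]
  linarith

/-- A discrete van Trees inequality, for the uniform prior on the grid `0, …, L`. -/
theorem sq_sub_le_sum_sq_error_mul (hp : ∀ m x, 0 < p m x) (hsum : ∀ m, ∑ x, p m x = 1)
    (T : X → ℝ) (g : Fin (L + 1) → ℝ) :
    (g (Fin.last L) - g 0) ^ 2 ≤
      (∑ m, ∑ x, p m x * (T x - g m) ^ 2) *
        (2 + ∑ t : Fin L, chiSqDiv (p t.succ) (p t.castSucc)) := by
  have sq_error_nonneg : 0 ≤ ∑ m, ∑ x, p m x * (T x - g m) ^ 2 :=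
    Finset.sum_nonneg fun m _ => Finset.sum_nonneg fun x _ => mul_nonneg (hp m x).le (sq_nonneg _)
  rw [← sum_sum_sub_mul_gridScore hsum T g]
  refine le_trans ?_ (mul_le_mul_of_nonneg_left (sum_sum_gridScore_sq_div_le hp hsum)
    sq_error_nonneg)
  simp only [← Fintype.sum_prod_type']
  refine Finset.sum_sq_le_sum_mul_sum_of_sq_le_mul _ (fun q _ => ?_) (fun q _ => ?_) fun q _ => ?_
  all_goals have := hp q.1 q.2
  · positivity
  · positivity
  · exact le_of_eq (by field_simp)

open scoped BigOperators

variable {ι : Type*} [Fintype ι] [DecidableEq ι]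

theorem expect_expect_update {β : Type*} [Fintype β] [Nonempty β] (l : ι) (F : (ι → β) → ℝ) :
    𝔼 θ, 𝔼 b, F (Function.update θ l b) = 𝔼 θ, F θ := by
  have swap_involutive :
      Function.Involutive fun q : (ι → β) × β => (Function.update q.1 l q.2, q.1 l) := by
    rintro ⟨θ, b⟩
    simp
  calc 𝔼 θ, 𝔼 b, F (Function.update θ l b)
      = 𝔼 q : (ι → β) × β, F (Function.update q.1 l q.2) := by
        rw [← Finset.univ_product_univ, Finset.expect_product]
    _ = 𝔼 q : (ι → β) × β, F q.1 := Fintype.expect_equiv swap_involutive.toPerm _ _ fun _ => rfl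
    _ = 𝔼 θ, F θ := by
        rw [← Finset.univ_product_univ, Finset.expect_product]
        simp only [Fintype.expect_const]

theorem sq_sub_div_le_expect_sq_error {p : (ι → Fin (L + 1)) → X → ℝ} (hp : ∀ θ x, 0 < p θ x)
    (hsum : ∀ θ, ∑ x, p θ x = 1) {χ : ℝ} (hχ0 : 0 ≤ χ) (l : ι)
    (hχ : ∀ θ (t : Fin L), chiSqDiv (p (Function.update θ l t.succ))
      (p (Function.update θ l t.castSucc)) ≤ χ) (T : X → ℝ) (g : Fin (L + 1) → ℝ) :
    (g (Fin.last L) - g 0) ^ 2 / ((L + 1) * (2 + L * χ)) ≤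
      𝔼 θ, ∑ x, p θ x * (T x - g (θ l)) ^ 2 := by
  rw [← expect_expect_update l]
  refine Finset.le_expect Finset.univ_nonempty fun θ _ => ?_
  have sum_chiSqDiv_le : ∑ t : Fin L, chiSqDiv (p (Function.update θ l t.succ))
      (p (Function.update θ l t.castSucc)) ≤ L * χ := by
    simpa using Finset.sum_le_card_nsmul Finset.univ _ χ fun t _ => hχ θ t
  have h := sq_sub_le_sum_sq_error_mul (p := fun b => p (Function.update θ l b)) (fun _ => hp _)
    (fun _ => hsum _) T g
  simp only [Function.update_self, Fintype.expect_eq_sum_div_card, Fintype.card_fin]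
  push_cast
  rw [div_le_div_iff₀ (by positivity) (by positivity), mul_left_comm, mul_comm _ ((L : ℝ) + 1)]
  refine mul_le_mul_of_nonneg_left (h.trans (mul_le_mul_of_nonneg_left (by linarith) ?_))
    (by positivity)
  exact Finset.sum_nonneg fun b _ => Finset.sum_nonneg fun x _ =>
    mul_nonneg (hp _ x).le (sq_nonneg _)

end VanTrees

section PathChiSquare

variable {k : ℕ} {C C' : MarkovChain k}

namespace MarkovChain

theorem pathProb_pos (hinit : ∀ j, 0 < C.init j) (htrans : ∀ i j, 0 < C.trans i j) (n : ℕ)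
    (x : Fin n → Fin k) : 0 < C.pathProb n x := by
  cases n with
  | zero => exact one_pos
  | succ m => exact mul_pos (hinit _) (Finset.prod_pos fun _ _ => htrans _ _)

theorem sum_sq_pathProb_div_pathProb (hinit : ∀ j, 0 < C.init j) (hinit_eq : C'.init = C.init)
    (m : ℕ) : ∑ x, C'.pathProb (m + 1) x ^ 2 / C.pathProb (m + 1) x =
      ∑ a, C.init a *
        pathExp (.of fun i j => C'.trans i j ^ 2 / C.trans i j) m a fun _ => 1 := by
  rw [sum_fin_succ_pi]
  refine Finset.sum_congr rfl fun a _ => ?_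
  rw [pathExp, Finset.mul_sum]
  refine Finset.sum_congr rfl fun y _ => ?_
  have := (hinit a).ne'
  rw [mul_one, ← pathWeight_sq_div_pathWeight]
  change (C'.init a * pathWeight C'.trans _) ^ 2 / (C.init a * pathWeight C.trans _) = _
  rw [hinit_eq, mul_pow, mul_div_mul_comm, sq (C.init a), mul_self_div_self]

theorem one_add_chiSqDiv_pathProb_le (hinit : ∀ j, 0 < C.init j)
    (htrans : ∀ i j, 0 < C.trans i j) (hinit_eq : C'.init = C.init) {R : ℝ}
    (h1 : ∑ a, C.init a * chiSqDiv (C'.trans a) (C.trans a) ≤ R)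
    (h2 : ∀ i, ∑ j, C'.trans i j ^ 2 / C.trans i j * chiSqDiv (C'.trans j) (C.trans j) ≤ R)
    (m : ℕ) : 1 + chiSqDiv (C'.pathProb (m + 1)) (C.pathProb (m + 1)) ≤ (1 + R) ^ (m + 1) := by
  set u : Fin k → ℝ := fun i => chiSqDiv (C'.trans i) (C.trans i)
  have u_nonneg (i : Fin k) : 0 ≤ u i := chiSqDiv_nonneg (htrans i) _
  have R_nonneg : 0 ≤ R :=
    (Finset.sum_nonneg fun a _ => mul_nonneg (hinit a).le (u_nonneg a)).trans h1
  have supersolution (i : Fin k) :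
      ∑ j, C'.trans i j ^ 2 / C.trans i j * (1 + u j) ≤ (1 + R) * (1 + u i) := by
    simp only [mul_add, mul_one, Finset.sum_add_distrib]
    rw [sum_sq_div_eq_one_add_chiSqDiv (htrans i)
      (Matrix.sum_row_of_mem_rowStochastic C.trans_mem i)
      (Matrix.sum_row_of_mem_rowStochastic C'.trans_mem i)]
    linarith [h2 i, mul_nonneg R_nonneg (u_nonneg i)]
  rw [← sum_sq_div_eq_one_add_chiSqDiv (pathProb_pos hinit htrans _)
    (C.pathProb_mem_stdSimplex _).2 (C'.pathProb_mem_stdSimplex _).2,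
    sum_sq_pathProb_div_pathProb hinit hinit_eq]
  calc _ ≤ ∑ a, C.init a * ((1 + R) ^ m * (1 + u a)) :=
        Finset.sum_le_sum fun a _ => mul_le_mul_of_nonneg_left
          (pathExp_one_le_pow_mul (fun i j => div_nonneg (sq_nonneg _) (htrans i j).le)
            (by positivity) (fun a => by linarith [u_nonneg a]) supersolution m a) (hinit a).le
    _ = (1 + R) ^ m * (1 + ∑ a, C.init a * u a) := by
        simp only [mul_left_comm _ ((1 + R) ^ m), ← Finset.mul_sum]
        simp only [mul_add, mul_one, Finset.sum_add_distrib, C.init_mem.2]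
    _ ≤ (1 + R) ^ (m + 1) := by
        rw [pow_succ]
        gcongr

end MarkovChain

/-- The Fisher information per transition, in the direction `V`, of the transition matrix of a
chain whose states are independent with law `c`. -/
noncomputable def fisherInfo {α : Type*} [Fintype α] (c : α → ℝ) (V : α × α → ℝ) : ℝ :=
  ∑ q, c q.1 / c q.2 * V q ^ 2

theorem fisherInfo_nonneg {α : Type*} [Fintype α] {c : α → ℝ} (hc : ∀ a, 0 < c a)
    (V : α × α → ℝ) : 0 ≤ fisherInfo c V :=
  Finset.sum_nonneg fun q _ => mul_nonneg (div_pos (hc q.1) (hc q.2)).le (sq_nonneg _)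

theorem fisherInfo_const_mul {α : Type*} [Fintype α] (c : α → ℝ) (s : ℝ) (V : α × α → ℝ) :
    fisherInfo c (fun q => s * V q) = s ^ 2 * fisherInfo c V := by
  simp only [fisherInfo, mul_pow, Finset.mul_sum, mul_left_comm]

theorem sum_mul_chiSqDiv_le_mul_fisherInfo {α : Type*} [Fintype α] {c : α → ℝ}
    {M : Matrix α α ℝ} {B : ℝ} (hc : ∀ a, 0 < c a) (hB : 0 < B) (h : ∀ i j, c j ≤ B * M i j)
    (M' : Matrix α α ℝ) :
    ∑ i, c i * chiSqDiv (M' i) (M i) ≤ B * fisherInfo c fun q => M' q.1 q.2 - M q.1 q.2 := by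
  calc ∑ i, c i * chiSqDiv (M' i) (M i)
      ≤ ∑ i, c i * (B * ∑ j, (M' i j - M i j) ^ 2 / c j) :=
        Finset.sum_le_sum fun i _ => mul_le_mul_of_nonneg_left
          (chiSqDiv_le_mul_sum_sq_div hc hB (h i) _) (hc i).le
    _ = B * fisherInfo c fun q => M' q.1 q.2 - M q.1 q.2 := by
        simp only [fisherInfo, Fintype.sum_prod_type, Finset.mul_sum]
        exact Finset.sum_congr rfl fun _ _ => Finset.sum_congr rfl fun _ _ => by ring

theorem sq_div_le_of_le_mul {B c x y : ℝ} (hB : 0 < B) (hc : 0 < c) (hy : 0 ≤ y)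
    (hx : c ≤ B * x) (hyc : y ≤ B * c) : y ^ 2 / x ≤ B ^ 3 * c := by
  calc y ^ 2 / x ≤ (B * c) ^ 2 / (c / B) := by
        gcongr
        exact (div_le_iff₀' hB).2 hx
    _ = B ^ 3 * c := by field_simp

namespace MarkovChain

theorem one_add_chiSqDiv_pathProb_le_exp {B : ℝ} (hinit : ∀ j, 0 < C.init j)
    (hinit_eq : C'.init = C.init) (hB : 1 ≤ B) (h : ∀ i j, C.init j ≤ B * C.trans i j)
    (h' : ∀ i j, C'.trans i j ≤ B * C.init j) (m : ℕ) :
    1 + chiSqDiv (C'.pathProb (m + 1)) (C.pathProb (m + 1)) ≤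
      Real.exp ((m + 1) * (B ^ 4 *
        fisherInfo C.init fun q => C'.trans q.1 q.2 - C.trans q.1 q.2)) := by
  have B_pos : 0 < B := one_pos.trans_le hB
  have htrans (i j : Fin k) : 0 < C.trans i j :=
    pos_of_mul_pos_right ((hinit j).trans_le (h i j)) B_pos.le
  set I := fisherInfo C.init fun q => C'.trans q.1 q.2 - C.trans q.1 q.2
  have I_nonneg : 0 ≤ I := fisherInfo_nonneg hinit _
  have sum_init_mul_le : ∑ a, C.init a * chiSqDiv (C'.trans a) (C.trans a) ≤ B * I :=
    sum_mul_chiSqDiv_le_mul_fisherInfo hinit B_pos h C'.trans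
  have sq_div_le (i j : Fin k) : C'.trans i j ^ 2 / C.trans i j ≤ B ^ 3 * C.init j :=
    sq_div_le_of_le_mul B_pos (hinit j) (Matrix.nonneg_of_mem_rowStochastic C'.trans_mem)
      (h i j) (h' i j)
  calc _ ≤ (1 + B ^ 4 * I) ^ (m + 1) := by
        refine one_add_chiSqDiv_pathProb_le hinit htrans hinit_eq
          (sum_init_mul_le.trans ?_) (fun i => ?_) m
        · exact mul_le_mul_of_nonneg_right (le_self_pow₀ hB (by norm_num)) I_nonneg
        · calc _ ≤ ∑ j, B ^ 3 * C.init j * chiSqDiv (C'.trans j) (C.trans j) :=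
                Finset.sum_le_sum fun j _ => mul_le_mul_of_nonneg_right (sq_div_le i j)
                  (chiSqDiv_nonneg (htrans j) _)
            _ ≤ B ^ 3 * (B * I) := by
                simp only [mul_assoc, ← Finset.mul_sum]
                gcongr
            _ = B ^ 4 * I := by ring
    _ ≤ Real.exp (B ^ 4 * I) ^ (m + 1) := by
        gcongr
        linarith [Real.add_one_le_exp (B ^ 4 * I)]
    _ = Real.exp ((m + 1) * (B ^ 4 * I)) := by rw [← Real.exp_nat_mul, Nat.cast_succ]

end MarkovChain

end PathChiSquare

section Perturbation

variable {k n : ℕ}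

/-- The entries of a square matrix, as a vector of the Euclidean space. -/
def entryVec (M : Matrix (Fin k) (Fin k) ℝ) : EuclideanSpace ℝ (Fin k × Fin k) :=
  WithLp.toLp 2 fun q => M q.1 q.2

/-- The outer product of two Euclidean vectors. -/
def outerVec (u v : EuclideanSpace ℝ (Fin k)) : EuclideanSpace ℝ (Fin k × Fin k) :=
  WithLp.toLp 2 fun q => u q.1 * v q.2

theorem inner_outerVec_left (u v : EuclideanSpace ℝ (Fin k))
    (w : EuclideanSpace ℝ (Fin k × Fin k)) :
    inner ℝ (outerVec u v) w = ∑ i, u i * ∑ j, v j * w (i, j) := by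
  simp only [PiLp.inner_apply, Fintype.sum_prod_type, outerVec, RCLike.inner_apply, conj_trivial,
    Finset.mul_sum]
  exact Finset.sum_congr rfl fun _ _ => Finset.sum_congr rfl fun _ _ => by ring

theorem inner_outerVec_outerVec (u v u' v' : EuclideanSpace ℝ (Fin k)) :
    inner ℝ (outerVec u v) (outerVec u' v') = inner ℝ u u' * inner ℝ v v' := by
  rw [inner_outerVec_left]
  simp only [outerVec, PiLp.inner_apply, RCLike.inner_apply, conj_trivial]
  rw [Finset.sum_mul_sum]
  refine Finset.sum_congr rfl fun _ _ => ?_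
  rw [Finset.mul_sum]
  exact Finset.sum_congr rfl fun _ _ => by ring

theorem orthonormal_outerVec {ι κ : Type*} {u : ι → EuclideanSpace ℝ (Fin k)}
    {v : κ → EuclideanSpace ℝ (Fin k)} (hu : Orthonormal ℝ u) (hv : Orthonormal ℝ v) :
    Orthonormal ℝ fun l : ι × κ => outerVec (u l.1) (v l.2) := by
  classical
  rw [orthonormal_iff_ite] at hu hv ⊢
  intro l l'
  rw [inner_outerVec_outerVec, hu, hv, ite_zero_mul_ite_zero, mul_one]
  simp only [Prod.ext_iff]

theorem fisherInfo_outerVec (c : Fin k → ℝ) (u v : EuclideanSpace ℝ (Fin k)) :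
    fisherInfo c (outerVec u v) = (∑ i, c i * u i ^ 2) * ∑ j, v j ^ 2 / c j := by
  simp only [fisherInfo, outerVec, Fintype.sum_prod_type, Finset.sum_mul_sum]
  exact Finset.sum_congr rfl fun _ _ => Finset.sum_congr rfl fun _ _ => by ring

theorem exists_orthonormal_forall_inner_eq_zero {E : Type*} [NormedAddCommGroup E]
    [InnerProductSpace ℝ E] [FiniteDimensional ℝ E] {d r : ℕ}
    (hdr : d + r ≤ Module.finrank ℝ E) (w : Fin r → E) :
    ∃ v : Fin d → E, Orthonormal ℝ v ∧ ∀ l t, inner ℝ (w t) (v l) = 0 := by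
  set S : Submodule ℝ E := Submodule.span ℝ (Set.range w)
  have finrank_le : Module.finrank ℝ S ≤ r := by
    simpa [Set.finrank] using finrank_range_le_card (R := ℝ) w
  have d_le : d ≤ Module.finrank ℝ Sᗮ := by
    have := S.finrank_add_finrank_orthogonal
    omega
  set b := stdOrthonormalBasis ℝ Sᗮ
  refine ⟨fun l => b (Fin.castLE d_le l), ?_, fun l t => ?_⟩
  · exact (b.orthonormal.comp _ (Fin.castLE_injective d_le)).comp_linearIsometry Sᗮ.subtypeₗᵢ
  · exact Submodule.inner_right_of_mem_orthogonal (Submodule.subset_span (Set.mem_range_self t))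
      (b (Fin.castLE d_le l)).2

/-- The expected squared error of the estimator `E` in the direction `v`. -/
noncomputable def directionalRisk (C : MarkovChain k) (E : TransitionEstimator k n)
    (v : EuclideanSpace ℝ (Fin k × Fin k)) : ℝ :=
  ∑ x, C.pathProb n x * (inner ℝ v (entryVec (C.trans - (E x : Matrix (Fin k) (Fin k) ℝ)))) ^ 2

theorem sum_directionalRisk_le_sum_stateRisk {ι : Type*} [Fintype ι]
    {V : ι → EuclideanSpace ℝ (Fin k × Fin k)} (hV : Orthonormal ℝ V) (C : MarkovChain k)
    (E : TransitionEstimator k n) :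
    ∑ l, directionalRisk C E (V l) ≤ ∑ i, stateRisk C E i := by
  simp only [directionalRisk, stateRisk]
  rw [Finset.sum_comm, Finset.sum_comm (s := (Finset.univ : Finset (Fin k)))]
  refine Finset.sum_le_sum fun x _ => ?_
  simp only [← Finset.mul_sum]
  refine mul_le_mul_of_nonneg_left ?_ ((C.pathProb_mem_stdSimplex n).1 x)
  have bessel := hV.sum_inner_products_le
    (entryVec (C.trans - (E x : Matrix (Fin k) (Fin k) ℝ))) (s := Finset.univ)
  simpa [EuclideanSpace.norm_sq_eq, Fintype.sum_prod_type, entryVec, l2Loss] using bessel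

theorem sum_directionalRisk_outerVec_single_le_stateRisk {ι : Type*} [Fintype ι]
    {v : ι → EuclideanSpace ℝ (Fin k)} (hv : Orthonormal ℝ v) (C : MarkovChain k)
    (E : TransitionEstimator k n) (i : Fin k) :
    ∑ l, directionalRisk C E (outerVec (EuclideanSpace.single i 1) (v l)) ≤ stateRisk C E i := by
  simp only [directionalRisk, stateRisk]
  rw [Finset.sum_comm]
  refine Finset.sum_le_sum fun x _ => ?_
  rw [← Finset.mul_sum]
  refine mul_le_mul_of_nonneg_left ?_ ((C.pathProb_mem_stdSimplex n).1 x)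
  have inner_eq (D : Matrix (Fin k) (Fin k) ℝ) (l : ι) :
      inner ℝ (outerVec (EuclideanSpace.single i 1) (v l)) (entryVec D) =
        inner ℝ (v l) (WithLp.toLp 2 (D i) : EuclideanSpace ℝ (Fin k)) := by
    rw [inner_outerVec_left]
    simp [PiLp.inner_apply, entryVec, mul_comm]
  have bessel := hv.sum_inner_products_le (s := Finset.univ)
    (WithLp.toLp 2 ((C.trans - (E x : Matrix (Fin k) (Fin k) ℝ)) i) : EuclideanSpace ℝ (Fin k))
  simpa only [inner_eq, EuclideanSpace.norm_sq_eq, Real.norm_eq_abs, sq_abs, l2Loss,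
    Matrix.sub_apply] using bessel

end Perturbation

section LocalGrid

open scoped BigOperators

theorem exists_mem_stdSimplex_vecMul_eq_self {α : Type*} [Fintype α] [DecidableEq α] [Nonempty α]
    {M : Matrix α α ℝ} (hM : M ∈ Matrix.rowStochastic ℝ α) :
    ∃ p ∈ stdSimplex ℝ α, Matrix.vecMul p M = p := by
  have det_eq_zero : (M - 1).det = 0 := by
    refine Matrix.exists_mulVec_eq_zero_iff.1 ⟨1, one_ne_zero, ?_⟩
    rw [Matrix.sub_mulVec, Matrix.one_vecMul_of_mem_rowStochastic hM, Matrix.one_mulVec, sub_self]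
  obtain ⟨v, v_ne_zero, hv⟩ := Matrix.exists_vecMul_eq_zero_iff.2 det_eq_zero
  rw [Matrix.vecMul_sub, Matrix.vecMul_one, sub_eq_zero] at hv
  -- `|v|` is stationary as well: `|v| ≤ |v| M` entrywise, and both sides have the same sum.
  have abs_le (j : α) : |v j| ≤ ∑ i, |v i| * M i j := by
    conv_lhs => rw [← hv]
    refine (Finset.abs_sum_le_sum_abs _ _).trans_eq (Finset.sum_congr rfl fun i _ => ?_)
    rw [abs_mul, abs_of_nonneg (Matrix.nonneg_of_mem_rowStochastic hM)]
  have sum_eq : ∑ j, |v j| = ∑ j, ∑ i, |v i| * M i j := by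
    rw [Finset.sum_comm]
    simp only [← Finset.mul_sum, Matrix.sum_row_of_mem_rowStochastic hM, mul_one]
  have abs_eq := (Finset.sum_eq_sum_iff_of_le fun j _ => abs_le j).1 sum_eq
  have sum_pos : 0 < ∑ j, |v j| := by
    obtain ⟨j, hj⟩ := Function.ne_iff.1 v_ne_zero
    exact Finset.sum_pos' (fun _ _ => abs_nonneg _) ⟨j, Finset.mem_univ j, abs_pos.2 hj⟩
  refine ⟨fun j => |v j| / ∑ j, |v j|, ⟨fun j => by positivity, ?_⟩, funext fun j => ?_⟩
  · rw [← Finset.sum_div, div_self sum_pos.ne']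
  · simp only [Matrix.vecMul, dotProduct, div_mul_eq_mul_div, ← Finset.sum_div]
    rw [← abs_eq j (Finset.mem_univ j)]

theorem MarkovChain.exists_init_eq_trans_eq {k : ℕ} {c : Fin k → ℝ}
    {M : Matrix (Fin k) (Fin k) ℝ} (hc : c ∈ stdSimplex ℝ (Fin k))
    (hM : M ∈ Matrix.rowStochastic ℝ (Fin k)) :
    ∃ C : MarkovChain k, C.init = c ∧ C.trans = M := by
  have : Nonempty (Fin k) := by
    by_contra h
    have := not_nonempty_iff.1 h
    simpa using hc.2
  obtain ⟨p, hp, hpM⟩ := exists_mem_stdSimplex_vecMul_eq_self hM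
  exact ⟨⟨c, M, p, hc, hM, hp, hpM⟩, rfl, rfl⟩

theorem eventually_le_vanTrees_bound {I κ : ℝ} (hI : 0 ≤ I) (hκ : 0 ≤ κ) (hκI : κ * I < 1) :
    ∀ᶠ a in 𝓝[>] (0 : ℝ), ∀ᶠ L : ℕ in atTop,
      κ ≤ (a * L) ^ 2 / ((L + 1) * (2 + L * (Real.exp (a ^ 2 * I) - 1))) := by
  have lt_one : ∀ᶠ a in 𝓝 (0 : ℝ), κ * I * (1 + a ^ 2 * I) < 1 :=
    ContinuousAt.eventually_lt (by fun_prop) continuousAt_const (by simpa using hκI)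
  have sq_mul_lt_one : ∀ᶠ a in 𝓝 (0 : ℝ), a ^ 2 * I < 1 :=
    ContinuousAt.eventually_lt (by fun_prop) continuousAt_const (by simp)
  filter_upwards [lt_one.filter_mono nhdsWithin_le_nhds,
    sq_mul_lt_one.filter_mono nhdsWithin_le_nhds, self_mem_nhdsWithin] with a h1 h2 ha
  rw [Set.mem_Ioi] at ha
  set D := Real.exp (a ^ 2 * I) - 1
  have D_nonneg : 0 ≤ D := sub_nonneg.2 (Real.one_le_exp (by positivity))
  have D_le : D ≤ a ^ 2 * I + (a ^ 2 * I) ^ 2 := by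
    have := le_of_abs_le (Real.abs_exp_sub_one_sub_id_le (x := a ^ 2 * I)
      (by rw [abs_of_nonneg (by positivity)]; exact h2.le))
    linarith
  have κ_mul_D_lt : κ * D < a ^ 2 := by
    calc κ * D ≤ κ * (a ^ 2 * I + (a ^ 2 * I) ^ 2) := by gcongr
      _ = a ^ 2 * (κ * I * (1 + a ^ 2 * I)) := by ring
      _ < a ^ 2 := mul_lt_of_lt_one_right (by positivity) h1
  have inv_tendsto := tendsto_inv_atTop_nhds_zero_nat (𝕜 := ℝ)
  have denom_tendsto : Tendsto (fun L : ℕ => κ * ((1 + (L : ℝ)⁻¹) * (2 * (L : ℝ)⁻¹ + D))) atTop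
      (𝓝 (κ * ((1 + 0) * (2 * 0 + D)))) :=
    ((inv_tendsto.const_add 1).mul ((inv_tendsto.const_mul 2).add_const D)).const_mul κ
  filter_upwards [denom_tendsto.eventually_lt_const (by simpa using κ_mul_D_lt),
    eventually_gt_atTop 0] with L hL L_pos
  rw [le_div_iff₀ (by positivity), mul_pow]
  calc κ * ((L + 1) * (2 + L * D))
      = κ * ((1 + (L : ℝ)⁻¹) * (2 * (L : ℝ)⁻¹ + D)) * (L : ℝ) ^ 2 := by field_simp
    _ ≤ a ^ 2 * (L : ℝ) ^ 2 := mul_le_mul_of_nonneg_right hL.le (sq_nonneg _)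

theorem exists_forall_le_vanTrees_bound {ι : Type*} [Finite ι] {I κ : ι → ℝ} (hI : ∀ l, 0 ≤ I l)
    (hκ : ∀ l, 0 ≤ κ l) (hκI : ∀ l, κ l * I l < 1) :
    ∃ B : ℝ, 1 < B ∧ ∃ a : ℝ, ∃ L : ℕ, ∀ l,
      κ l ≤ (a * L) ^ 2 / ((L + 1) * (2 + L * (Real.exp (a ^ 2 * (B ^ 4 * I l)) - 1))) := by
  have lt_one : ∀ᶠ B in 𝓝[>] (1 : ℝ), ∀ l, κ l * (B ^ 4 * I l) < 1 :=
    eventually_all.2 fun l => (ContinuousAt.eventually_lt (by fun_prop) continuousAt_const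
      (by simpa using hκI l)).filter_mono nhdsWithin_le_nhds
  obtain ⟨B, hB, one_lt_B⟩ := (lt_one.and self_mem_nhdsWithin).exists
  obtain ⟨a, ha⟩ := (eventually_all.2 fun l => eventually_le_vanTrees_bound
    (mul_nonneg (by positivity) (hI l)) (hκ l) (hB l)).exists
  obtain ⟨L, hL⟩ := (eventually_all.2 ha).exists
  exact ⟨B, one_lt_B, a, L, hL⟩

variable {ι : Type*} [Fintype ι] {k L : ℕ} {c : Fin k → ℝ}
  {V : ι → EuclideanSpace ℝ (Fin k × Fin k)} {s : ℝ}
  {C : (ι → Fin (L + 1)) → MarkovChain k}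

/-- The chains `C θ` start from `c` and their transition matrices are the points of a grid of step
`s` in the directions `V`, based at the matrix all of whose rows are `c`. -/
structure IsLocalGrid (c : Fin k → ℝ) (V : ι → EuclideanSpace ℝ (Fin k × Fin k)) (s : ℝ)
    (C : (ι → Fin (L + 1)) → MarkovChain k) : Prop where
  init_eq : ∀ θ, (C θ).init = c
  trans_apply : ∀ θ i j, (C θ).trans i j = c j + s * ∑ l, (θ l : ℝ) * V l (i, j)

theorem exists_isLocalGrid (hc : c ∈ stdSimplex ℝ (Fin k)) (hrow : ∀ l i, ∑ j, V l (i, j) = 0)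
    (hs : ∀ (θ : ι → Fin (L + 1)) i j, |s * ∑ l, (θ l : ℝ) * V l (i, j)| ≤ c j) :
    ∃ C : (ι → Fin (L + 1)) → MarkovChain k, IsLocalGrid c V s C := by
  have mem_rowStochastic (θ : ι → Fin (L + 1)) :
      Matrix.of (fun i j => c j + s * ∑ l, (θ l : ℝ) * V l (i, j)) ∈
        Matrix.rowStochastic ℝ (Fin k) := by
    refine mem_rowStochastic_of_row_mem fun i => ⟨fun j => ?_, ?_⟩
    · exact neg_le_iff_add_nonneg'.1 (neg_le_of_abs_le (hs θ i j))
    · simp only [Matrix.of_apply, Finset.sum_add_distrib, hc.2, ← Finset.mul_sum]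
      rw [Finset.sum_comm]
      simp only [← Finset.mul_sum, hrow, mul_zero, Finset.sum_const_zero, add_zero]
  choose C hinit htrans using fun θ =>
    MarkovChain.exists_init_eq_trans_eq hc (mem_rowStochastic θ)
  exact ⟨C, hinit, fun θ i j => by rw [htrans, Matrix.of_apply]⟩

namespace IsLocalGrid

theorem inner_entryVec_trans (hC : IsLocalGrid c V s C) (hV : Orthonormal ℝ V)
    (θ : ι → Fin (L + 1)) (l : ι) :
    inner ℝ (V l) (entryVec (C θ).trans) =
      inner ℝ (V l) (entryVec (Matrix.of fun _ => c)) + s * θ l := by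
  have entryVec_trans : entryVec (C θ).trans =
      entryVec (Matrix.of fun _ => c) + s • ∑ l, (θ l : ℝ) • V l := by
    ext q
    simp [entryVec, hC.trans_apply]
  rw [entryVec_trans, inner_add_right, inner_smul_right, hV.inner_right_fintype]

variable [DecidableEq ι]

theorem trans_update_succ_sub (hC : IsLocalGrid c V s C) (θ : ι → Fin (L + 1))
    (l : ι) (t : Fin L) (i j : Fin k) :
    (C (Function.update θ l t.succ)).trans i j - (C (Function.update θ l t.castSucc)).trans i j =
      s * V l (i, j) := by
  rw [hC.trans_apply, hC.trans_apply, add_sub_add_left_eq_sub, ← mul_sub,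
    ← Finset.sum_sub_distrib, Finset.sum_eq_single l]
  · simp only [Function.update_self, Fin.val_succ, Fin.val_castSucc, Nat.cast_succ]
    ring
  · intro l' _ hl'
    simp only [Function.update_of_ne hl', sub_self]
  · exact fun h => absurd (Finset.mem_univ l) h

theorem div_le_expect_directionalRisk (hC : IsLocalGrid c V s C) (hc : ∀ j, 0 < c j)
    (hV : Orthonormal ℝ V) {B : ℝ} (hB : 1 ≤ B) (h : ∀ θ i j, c j ≤ B * (C θ).trans i j)
    (h' : ∀ θ i j, (C θ).trans i j ≤ B * c j) {m : ℕ} (E : TransitionEstimator k (m + 1))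
    (l : ι) :
    (s * L) ^ 2 / ((L + 1) * (2 + L *
        (Real.exp ((m + 1) * (B ^ 4 * (s ^ 2 * fisherInfo c (V l)))) - 1))) ≤
      𝔼 θ, directionalRisk (C θ) E (V l) := by
  have hinit (θ) (j : Fin k) : 0 < (C θ).init j := by simpa only [hC.init_eq] using hc j
  have htrans (θ) (i j : Fin k) : 0 < (C θ).trans i j :=
    pos_of_mul_pos_right ((hc j).trans_le (h θ i j)) (zero_le_one.trans hB)
  have chiSqDiv_le (θ) (t : Fin L) :
      chiSqDiv ((C (Function.update θ l t.succ)).pathProb (m + 1))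
          ((C (Function.update θ l t.castSucc)).pathProb (m + 1)) ≤
        Real.exp ((m + 1) * (B ^ 4 * (s ^ 2 * fisherInfo c (V l)))) - 1 := by
    rw [le_sub_iff_add_le']
    have h_exp := MarkovChain.one_add_chiSqDiv_pathProb_le_exp
      (hinit (Function.update θ l t.castSucc)) ((hC.init_eq (Function.update θ l t.succ)).trans
        (hC.init_eq _).symm) hB (fun i j => by rw [hC.init_eq]; exact h _ i j)
      (fun i j => by rw [hC.init_eq]; exact h' _ i j) m
    simpa only [hC.trans_update_succ_sub, hC.init_eq, fisherInfo_const_mul] using h_exp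
  have vanTrees := sq_sub_div_le_expect_sq_error
    (p := fun θ => (C θ).pathProb (m + 1)) (fun θ => (C θ).pathProb_pos (hinit θ) (htrans θ) _)
    (fun θ => ((C θ).pathProb_mem_stdSimplex _).2)
    (sub_nonneg.2 (Real.one_le_exp (by have := fisherInfo_nonneg hc (V l); positivity))) l
    chiSqDiv_le (fun x => inner ℝ (V l) (entryVec (E x : Matrix (Fin k) (Fin k) ℝ)))
    (fun b => inner ℝ (V l) (entryVec (Matrix.of fun _ => c)) + s * b)
  refine le_of_eq_of_le ?_ (vanTrees.trans_eq ?_)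
  · simp only [add_sub_add_left_eq_sub, Fin.val_last, Fin.val_zero, Nat.cast_zero, mul_zero,
      sub_zero]
  · refine Finset.expect_congr rfl fun θ _ => Finset.sum_congr rfl fun x _ => ?_
    rw [← hC.inner_entryVec_trans hV, sub_sq_comm, ← inner_sub_right]
    rfl

theorem div_natCast_le_expect_directionalRisk {a : ℝ} {m : ℕ}
    (hC : IsLocalGrid c V (a / √(m + 1 : ℕ)) C) (hc : ∀ j, 0 < c j) (hV : Orthonormal ℝ V)
    {B : ℝ} (hB : 1 ≤ B) (h : ∀ θ i j, c j ≤ B * (C θ).trans i j)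
    (h' : ∀ θ i j, (C θ).trans i j ≤ B * c j) (E : TransitionEstimator k (m + 1)) (l : ι) :
    (a * L) ^ 2 / ((L + 1) * (2 + L *
        (Real.exp (a ^ 2 * (B ^ 4 * fisherInfo c (V l))) - 1))) / (m + 1 : ℕ) ≤
      𝔼 θ, directionalRisk (C θ) E (V l) := by
  refine le_of_eq_of_le ?_ (hC.div_le_expect_directionalRisk hc hV hB h h' E l)
  have sq_sqrt : √((m + 1 : ℕ) : ℝ) ^ 2 = m + 1 := by
    rw [Real.sq_sqrt (Nat.cast_nonneg _), Nat.cast_succ]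
  have exponent_eq : (m + 1 : ℝ) * (B ^ 4 * (a ^ 2 / (m + 1) * fisherInfo c (V l))) =
      a ^ 2 * (B ^ 4 * fisherInfo c (V l)) := by field_simp
  rw [mul_pow, mul_pow, div_pow, sq_sqrt, exponent_eq, Nat.cast_succ]
  ring

end IsLocalGrid

theorem eventually_abs_div_sqrt_mul_le (a x : ℝ) {ε : ℝ} (hε : 0 < ε) :
    ∀ᶠ n : ℕ in atTop, |a / √n * x| ≤ ε := by
  have abs_tendsto := (((Real.tendsto_sqrt_atTop.comp
    tendsto_natCast_atTop_atTop).const_div_atTop a).mul_const x).abs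
  rw [zero_mul, abs_zero] at abs_tendsto
  exact abs_tendsto.eventually_le_const hε

theorem le_mul_add_of_abs_le {B c x : ℝ} (hB : 0 < B) (hx : |x| ≤ (1 - 1 / B) * c) :
    c ≤ B * (c + x) := by
  calc c = B * (c - (1 - 1 / B) * c) := by field_simp; ring
    _ ≤ B * (c + x) := by gcongr; linarith [neg_le_of_abs_le hx]

theorem add_le_mul_of_abs_le {B c x : ℝ} (hB : 0 < B) (hc : 0 ≤ c)
    (hx : |x| ≤ (1 - 1 / B) * c) : c + x ≤ B * c := by
  have two_le : 2 ≤ B + 1 / B := by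
    have : B + 1 / B - 2 = (B - 1) ^ 2 / B := by field_simp; ring
    have : 0 ≤ (B - 1) ^ 2 / B := by positivity
    linarith
  calc c + x ≤ (2 - 1 / B) * c := by linarith [le_of_abs_le hx]
    _ ≤ B * c := by gcongr; linarith

theorem exists_isLocalGrid_div_le_expect_directionalRisk [DecidableEq ι]
    (hc_mem : c ∈ stdSimplex ℝ (Fin k)) (hc : ∀ j, 0 < c j) (hV : Orthonormal ℝ V)
    (hrow : ∀ l i, ∑ j, V l (i, j) = 0) {κ : ι → ℝ} (hκ : ∀ l, 0 ≤ κ l)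
    (hκV : ∀ l, κ l * fisherInfo c (V l) < 1) {ρ : ℝ} (hρ : 0 < ρ) :
    ∃ L : ℕ, ∀ᶠ n : ℕ in atTop, ∃ s, ∃ C : (ι → Fin (L + 1)) → MarkovChain k,
      IsLocalGrid c V s C ∧ (∀ θ i j, |(C θ).trans i j - c j| ≤ ρ) ∧
        ∀ (E : TransitionEstimator k n) l, κ l / n ≤ 𝔼 θ, directionalRisk (C θ) E (V l) := by
  obtain ⟨B, one_lt_B, a, L, hL⟩ :=
    exists_forall_le_vanTrees_bound (fun l => fisherInfo_nonneg hc (V l)) hκ hκV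
  have B_pos : 0 < B := one_pos.trans one_lt_B
  have one_sub_pos : 0 < 1 - 1 / B := sub_pos.2 ((div_lt_one B_pos).2 one_lt_B)
  have close : ∀ᶠ n : ℕ in atTop, ∀ (θ : ι → Fin (L + 1)) i j,
      |a / √n * ∑ l, (θ l : ℝ) * V l (i, j)| ≤ min ρ ((1 - 1 / B) * c j) := by
    simp only [eventually_all]
    exact fun θ i j => eventually_abs_div_sqrt_mul_le a _ (lt_min hρ (mul_pos one_sub_pos (hc j)))
  refine ⟨L, ?_⟩
  filter_upwards [close, eventually_ne_atTop 0] with n close n_ne_zero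
  obtain ⟨m, rfl⟩ := Nat.exists_eq_succ_of_ne_zero n_ne_zero
  have close_mul (θ i j) := (close θ i j).trans (min_le_right _ _)
  obtain ⟨C, hC⟩ := exists_isLocalGrid hc_mem hrow fun θ i j => (close_mul θ i j).trans
    (mul_le_of_le_one_left (hc j).le (sub_le_self _ (by positivity)))
  refine ⟨_, C, hC, fun θ i j => ?_, fun E l => ?_⟩
  · rw [hC.trans_apply, add_sub_cancel_left]
    exact (close θ i j).trans (min_le_left _ _)
  · refine (div_le_div_of_nonneg_right (hL l) (Nat.cast_nonneg _)).trans
      (hC.div_natCast_le_expect_directionalRisk hc hV one_lt_B.le (fun θ i j => ?_)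
        (fun θ i j => ?_) E l)
    · rw [hC.trans_apply]
      exact le_mul_add_of_abs_le B_pos (close_mul θ i j)
    · rw [hC.trans_apply]
      exact add_le_mul_of_abs_le B_pos (hc j).le (close_mul θ i j)

end LocalGrid

section LowerBounds

open scoped BigOperators

variable {k : ℕ} {δ pmin : ℝ}

theorem exists_orthonormal_sum_eq_zero (hk : 1 ≤ k) :
    ∃ v : Fin (k - 1) → EuclideanSpace ℝ (Fin k), Orthonormal ℝ v ∧ ∀ l, ∑ j, v l j = 0 := by
  obtain ⟨v, hv, hvw⟩ := exists_orthonormal_forall_inner_eq_zero (d := k - 1)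
    (by rw [finrank_euclideanSpace_fin]; omega)
    ![(WithLp.toLp 2 1 : EuclideanSpace ℝ (Fin k))]
  exact ⟨v, hv, fun l => by simpa [PiLp.inner_apply] using hvw l 0⟩

theorem exists_orthonormal_sum_eq_zero_apply_eq_zero (hk : 2 ≤ k) (j₀ : Fin k) :
    ∃ v : Fin (k - 2) → EuclideanSpace ℝ (Fin k), Orthonormal ℝ v ∧ (∀ l, ∑ j, v l j = 0) ∧
      ∀ l, v l j₀ = 0 := by
  obtain ⟨v, hv, hvw⟩ := exists_orthonormal_forall_inner_eq_zero (d := k - 2)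
    (by rw [finrank_euclideanSpace_fin]; omega)
    ![(WithLp.toLp 2 1 : EuclideanSpace ℝ (Fin k)), EuclideanSpace.single j₀ 1]
  exact ⟨v, hv, fun l => by simpa [PiLp.inner_apply] using hvw l 0,
    fun l => by simpa [EuclideanSpace.inner_single_left] using hvw l 1⟩

theorem sum_sq_eq_one_of_orthonormal {ι : Type*} {v : ι → EuclideanSpace ℝ (Fin k)}
    (hv : Orthonormal ℝ v) (l : ι) : ∑ j, v l j ^ 2 = 1 := by
  rw [← one_pow 2, ← hv.1 l, EuclideanSpace.norm_sq_eq]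
  simp only [Real.norm_eq_abs, sq_abs]

theorem le_minimaxWeightedRisk_of_le_expect {𝓜 : Set (MarkovChain k)} {n : ℕ} {b : ℝ} {Θ : Type*}
    [Fintype Θ] [Nonempty Θ] {C : Θ → MarkovChain k} (hC : ∀ θ, C θ ∈ 𝓜)
    (h : ∀ E : TransitionEstimator k n, b ≤ 𝔼 θ, weightedRisk (C θ) E) :
    b ≤ minimaxWeightedRisk 𝓜 n := by
  have : Nonempty (TransitionEstimator k n) := ⟨empiricalEstimator k n⟩
  exact le_ciInf_ciSup_of_le_expect (R := fun E (C : 𝓜) => weightedRisk C.1 E)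
    (fun E => ⟨2, Set.forall_mem_range.2 fun C =>
      (weightedRisk_le_worstStateRisk C.1 E).trans (worstStateRisk_le_two C.1 E)⟩)
    (fun θ => ⟨C θ, hC θ⟩) h

theorem le_minimaxWorstStateRisk_of_le_expect {𝓜 : Set (MarkovChain k)} {n : ℕ} {b : ℝ}
    {Θ : Type*} [Fintype Θ] [Nonempty Θ] {C : Θ → MarkovChain k} (hC : ∀ θ, C θ ∈ 𝓜)
    (h : ∀ E : TransitionEstimator k n, b ≤ 𝔼 θ, worstStateRisk (C θ) E) :
    b ≤ minimaxWorstStateRisk 𝓜 n := by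
  have : Nonempty (TransitionEstimator k n) := ⟨empiricalEstimator k n⟩
  exact le_ciInf_ciSup_of_le_expect (R := fun E (C : 𝓜) => worstStateRisk C.1 E)
    (fun E => ⟨2, Set.forall_mem_range.2 fun C => worstStateRisk_le_two C.1 E⟩)
    (fun θ => ⟨C θ, hC θ⟩) h

theorem mem_lowerBoundedStat_of_trans_apply_eq {C : MarkovChain k} {j₀ : Fin k} (hδp : δ ≤ pmin)
    (h : ∀ i j, pmin ≤ C.trans i j) (h₀ : ∀ i, C.trans i j₀ = pmin) :
    C ∈ MarkovChain.lowerBoundedStat k δ pmin :=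
  ⟨fun i j => hδp.trans (h i j),
    ⟨j₀, le_antisymm (C.stat_le fun i => (h₀ i).le) (C.le_stat fun i => (h₀ i).ge)⟩,
    Set.forall_mem_range.2 fun j => C.le_stat fun i => h i j⟩

/-- The distribution with mass `p` at `j₀` that is uniform on the other points. -/
noncomputable def twoLevelLaw (j₀ : Fin k) (p : ℝ) (j : Fin k) : ℝ :=
  if j = j₀ then p else (1 - p) / (k - 1)

section TwoLevelLaw

variable {j₀ : Fin k}

theorem lt_one_sub_div_of_lt_one_div (hk : 2 ≤ k) (hpk : pmin < 1 / k) :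
    pmin < (1 - pmin) / (k - 1) := by
  have hk' : (2 : ℝ) ≤ k := by exact_mod_cast hk
  rw [lt_div_iff₀ (by linarith)] at hpk ⊢
  linarith

theorem le_twoLevelLaw (hp : pmin ≤ (1 - pmin) / (k - 1)) (j : Fin k) :
    pmin ≤ twoLevelLaw j₀ pmin j := by
  unfold twoLevelLaw
  split_ifs
  exacts [le_rfl, hp]

theorem twoLevelLaw_mem_stdSimplex (hk : 2 ≤ k) (hp0 : 0 ≤ pmin)
    (hp : pmin ≤ (1 - pmin) / (k - 1)) : twoLevelLaw j₀ pmin ∈ stdSimplex ℝ (Fin k) := by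
  refine ⟨fun j => hp0.trans (le_twoLevelLaw hp j), ?_⟩
  have hk' : (k : ℝ) - 1 ≠ 0 := (sub_pos.2 (by exact_mod_cast hk)).ne'
  have (j : Fin k) : twoLevelLaw j₀ pmin j =
      (1 - pmin) / (k - 1) + if j = j₀ then pmin - (1 - pmin) / (k - 1) else 0 := by
    unfold twoLevelLaw
    split_ifs <;> ring
  simp only [this, Finset.sum_add_distrib, Finset.sum_ite_eq', Finset.mem_univ, if_true,
    Finset.sum_const, Finset.card_univ, Fintype.card_fin, nsmul_eq_mul]
  field_simp
  ring

theorem fisherInfo_twoLevelLaw_outerVec_single {v : EuclideanSpace ℝ (Fin k)}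
    (hv : ∑ j, v j ^ 2 = 1) (hv₀ : v j₀ = 0) (i : Fin k) :
    fisherInfo (twoLevelLaw j₀ pmin) (outerVec (EuclideanSpace.single i 1) v) =
      twoLevelLaw j₀ pmin i / ((1 - pmin) / (k - 1)) := by
  have sq_div (j : Fin k) :
      v j ^ 2 / twoLevelLaw j₀ pmin j = v j ^ 2 / ((1 - pmin) / (k - 1)) := by
    unfold twoLevelLaw
    split_ifs with hj
    · simp [hj, hv₀]
    · rfl
  simp only [fisherInfo_outerVec, sq_div, ← Finset.sum_div, hv]
  simp [ite_pow, mul_ite, div_eq_mul_inv]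

theorem exists_isLocalGrid_twoLevelLaw (hk : 2 ≤ k) (hp0 : 0 < pmin)
    (hp : pmin < (1 - pmin) / (k - 1)) {v : Fin (k - 2) → EuclideanSpace ℝ (Fin k)}
    (hv : Orthonormal ℝ v) (sum_v : ∀ l, ∑ j, v l j = 0) (v_j₀ : ∀ l, v l j₀ = 0) {τ ρ : ℝ}
    (hτ0 : 0 ≤ τ) (hτ1 : τ < 1) (hρ : 0 < ρ) :
    ∃ L : ℕ, ∀ᶠ n : ℕ in atTop, ∃ (s : ℝ)
      (C : (Fin k × Fin (k - 2) → Fin (L + 1)) → MarkovChain k),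
      IsLocalGrid (twoLevelLaw j₀ pmin)
        (fun l => outerVec (EuclideanSpace.single l.1 1) (v l.2)) s C ∧
      (∀ θ i j, |(C θ).trans i j - twoLevelLaw j₀ pmin j| ≤ ρ) ∧
      ∀ (E : TransitionEstimator k n) (l : Fin k × Fin (k - 2)),
        τ * ((1 - pmin) / (k - 1)) / twoLevelLaw j₀ pmin l.1 / n ≤
          𝔼 θ, directionalRisk (C θ) E (outerVec (EuclideanSpace.single l.1 1) (v l.2)) := by
  have q_pos : 0 < (1 - pmin) / ((k : ℝ) - 1) := hp0.trans hp
  have c_pos (j : Fin k) : 0 < twoLevelLaw j₀ pmin j := hp0.trans_le (le_twoLevelLaw hp.le j)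
  refine exists_isLocalGrid_div_le_expect_directionalRisk
    (twoLevelLaw_mem_stdSimplex hk hp0.le hp.le) c_pos
    (orthonormal_outerVec (u := fun i : Fin k => EuclideanSpace.single i 1)
      EuclideanSpace.orthonormal_single hv)
    (fun l i => by simp only [outerVec, ← Finset.mul_sum, sum_v, mul_zero])
    (fun l => by have := c_pos l.1; positivity) (fun l => ?_) hρ
  rw [fisherInfo_twoLevelLaw_outerVec_single (sum_sq_eq_one_of_orthonormal hv _) (v_j₀ _),
    div_mul_div_cancel₀ (c_pos _).ne', mul_div_cancel_right₀ _ q_pos.ne']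
  exact hτ1

theorem exists_mem_lowerBoundedStat_le_expect_stateRisk (hk : 2 ≤ k) (hp0 : 0 < pmin)
    (hδp : δ ≤ pmin) (hp : pmin < (1 - pmin) / (k - 1)) (j₀ : Fin k) {τ : ℝ} (hτ0 : 0 ≤ τ)
    (hτ1 : τ < 1) :
    ∃ L : ℕ, ∀ᶠ n : ℕ in atTop, ∃ C : (Fin k × Fin (k - 2) → Fin (L + 1)) → MarkovChain k,
      (∀ θ, C θ ∈ MarkovChain.lowerBoundedStat k δ pmin) ∧
      (∀ θ i, τ * twoLevelLaw j₀ pmin i ≤ (C θ).stat i) ∧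
      ∀ (E : TransitionEstimator k n) i,
        (k - 2) * (τ * ((1 - pmin) / (k - 1)) / twoLevelLaw j₀ pmin i / n) ≤
          𝔼 θ, stateRisk (C θ) E i := by
  set c := twoLevelLaw j₀ pmin
  set q := (1 - pmin) / ((k : ℝ) - 1)
  obtain ⟨v, hv, sum_v, v_j₀⟩ := exists_orthonormal_sum_eq_zero_apply_eq_zero hk j₀
  obtain ⟨L, hL⟩ := exists_isLocalGrid_twoLevelLaw hk hp0 hp hv sum_v v_j₀ hτ0 hτ1
    (ρ := min ((1 - τ) * pmin) (q - pmin))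
    (lt_min (mul_pos (by linarith) hp0) (by linarith))
  refine ⟨L, hL.mono fun n ⟨s, C, hC, close, risk_ge⟩ => ⟨C, fun θ => ?_, fun θ j => ?_,
    fun E i => ?_⟩⟩
  · have trans_j₀ (i : Fin k) : (C θ).trans i j₀ = pmin := by
      simp [hC.trans_apply, outerVec, v_j₀, twoLevelLaw]
    have le_trans_apply (i j : Fin k) : pmin ≤ (C θ).trans i j := by
      by_cases hj : j = j₀
      · rw [hj, trans_j₀]
      · have := neg_le_of_abs_le ((close θ i j).trans (min_le_right _ _))
        have c_j : c j = q := if_neg hj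
        linarith
    exact mem_lowerBoundedStat_of_trans_apply_eq hδp le_trans_apply trans_j₀
  · refine (C θ).le_stat fun i => ?_
    have := neg_le_of_abs_le ((close θ i j).trans (min_le_left _ _))
    have := mul_le_mul_of_nonneg_left (le_twoLevelLaw (j₀ := j₀) hp.le j) (sub_nonneg.2 hτ1.le)
    linarith
  · calc (k - 2) * (τ * q / c i / n) = ∑ _l : Fin (k - 2), τ * q / c i / n := by
          simp [Nat.cast_sub hk]
      _ ≤ ∑ l, 𝔼 θ, directionalRisk (C θ) E (outerVec (EuclideanSpace.single i 1) (v l)) :=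
          Finset.sum_le_sum fun l _ => risk_ge E (i, l)
      _ ≤ 𝔼 θ, stateRisk (C θ) E i := by
          rw [← Finset.expect_sum_comm]
          exact Finset.expect_le_expect fun θ _ =>
            sum_directionalRisk_outerVec_single_le_stateRisk hv (C θ) E i

theorem eventually_le_minimaxWeightedRisk_of_lt (hk : 2 ≤ k) (hp0 : 0 < pmin) (hδp : δ ≤ pmin)
    (hpk : pmin < 1 / k) : ∀ᶠ n : ℕ in atTop,
      (1 - pmin) ^ 2 * (((k : ℝ) - k / (k - 1)) / n) ≤
        minimaxWeightedRisk (MarkovChain.lowerBoundedStat k δ pmin) n := by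
  have hp := lt_one_sub_div_of_lt_one_div hk hpk
  have hk' : (0 : ℝ) < k - 1 := sub_pos.2 (by exact_mod_cast hk)
  have pmin_lt_one : pmin < 1 := hpk.trans_le (div_le_one_of_le₀ (by linarith) (by linarith))
  set τ := √(1 - pmin)
  have τ_sq : τ ^ 2 = 1 - pmin := Real.sq_sqrt (by linarith)
  set c := twoLevelLaw (⟨0, by omega⟩ : Fin k) pmin
  have c_pos (i : Fin k) : 0 < c i := hp0.trans_le (le_twoLevelLaw hp.le i)
  obtain ⟨L, hL⟩ := exists_mem_lowerBoundedStat_le_expect_stateRisk hk hp0 hδp hp ⟨0, by omega⟩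
    (Real.sqrt_nonneg (1 - pmin)) ((Real.sqrt_lt' one_pos).2 (by linarith))
  refine hL.mono fun n ⟨C, hC, stat_ge, risk_ge⟩ =>
    le_minimaxWeightedRisk_of_le_expect hC fun E => ?_
  calc (1 - pmin) ^ 2 * (((k : ℝ) - k / (k - 1)) / n)
      = ∑ i, τ * c i * ((k - 2) * (τ * ((1 - pmin) / (k - 1)) / c i / n)) := by
        have summand_eq (i : Fin k) : τ * c i * ((k - 2) * (τ * ((1 - pmin) / (k - 1)) / c i / n)) =
            τ ^ 2 * ((k - 2) * ((1 - pmin) / (k - 1)) / n) := by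
          have := (c_pos i).ne'
          field_simp
        simp only [summand_eq, τ_sq, Finset.sum_const, Finset.card_univ, Fintype.card_fin,
          nsmul_eq_mul]
        field_simp
        ring
    _ ≤ ∑ i, τ * c i * 𝔼 θ, stateRisk (C θ) E i :=
        Finset.sum_le_sum fun i _ => mul_le_mul_of_nonneg_left (risk_ge E i)
          (mul_nonneg (Real.sqrt_nonneg _) (c_pos i).le)
    _ = 𝔼 θ, ∑ i, τ * c i * stateRisk (C θ) E i := by
        simp only [Finset.mul_expect, Finset.expect_sum_comm]
    _ ≤ 𝔼 θ, weightedRisk (C θ) E :=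
        Finset.expect_le_expect fun θ _ => Finset.sum_le_sum fun i _ =>
          mul_le_mul_of_nonneg_right (stat_ge θ i) (stateRisk_nonneg _ _ _)

theorem eventually_le_minimaxWorstStateRisk_of_lt (hk : 2 ≤ k) (hp0 : 0 < pmin)
    (hδp : δ ≤ pmin) (hpk : pmin < 1 / k) : ∀ᶠ n : ℕ in atTop,
      (1 - pmin) ^ 2 * ((1 - 1 / ((k : ℝ) - 1)) / (n * pmin)) ≤
        minimaxWorstStateRisk (MarkovChain.lowerBoundedStat k δ pmin) n := by
  have hp := lt_one_sub_div_of_lt_one_div hk hpk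
  have hk' : (0 : ℝ) < k - 1 := sub_pos.2 (by exact_mod_cast hk)
  have pmin_lt_one : pmin < 1 := hpk.trans_le (div_le_one_of_le₀ (by linarith) (by linarith))
  set τ := 1 - pmin
  have τ_pos : 0 < τ := by linarith
  set j₀ : Fin k := ⟨0, by omega⟩
  obtain ⟨L, hL⟩ := exists_mem_lowerBoundedStat_le_expect_stateRisk hk hp0 hδp hp j₀ τ_pos.le
    (by linarith)
  refine hL.mono fun n ⟨C, hC, _, risk_ge⟩ =>
    le_minimaxWorstStateRisk_of_le_expect hC fun E => ?_
  calc τ ^ 2 * ((1 - 1 / ((k : ℝ) - 1)) / (n * pmin))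
      = (k - 2) * (τ * (τ / (k - 1)) / twoLevelLaw j₀ pmin j₀ / n) := by
        rw [twoLevelLaw, if_pos rfl]
        field_simp
        ring
    _ ≤ 𝔼 θ, stateRisk (C θ) E j₀ := risk_ge E j₀
    _ ≤ 𝔼 θ, worstStateRisk (C θ) E :=
        Finset.expect_le_expect fun θ _ => stateRisk_le_worstStateRisk _ _ _

end TwoLevelLaw

theorem one_div_mem_stdSimplex (hk : 1 ≤ k) :
    (fun _ => 1 / k : Fin k → ℝ) ∈ stdSimplex ℝ (Fin k) := by
  have : (k : ℝ) ≠ 0 := by positivity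
  exact ⟨fun _ => by positivity, by simp [this]⟩

theorem stat_eq_one_div_of_sum_trans_eq_one {C : MarkovChain k} (hδ : 0 < δ)
    (hC : C ∈ MarkovChain.lowerBounded k δ) (h : ∀ j, ∑ i, C.trans i j = 1) (i : Fin k) :
    C.stat i = 1 / k := by
  refine congrFun (stationary_unique C.trans_mem hδ hC C.stat_mem
    (one_div_mem_stdSimplex (Fin.pos i)) C.stat_vecMul (funext fun j => ?_)) i
  simp only [Matrix.vecMul, dotProduct, ← Finset.mul_sum, h, mul_one]

theorem fisherInfo_one_div_outerVec {u v : EuclideanSpace ℝ (Fin k)} (hk : 1 ≤ k)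
    (hu : ∑ i, u i ^ 2 = 1) (hv : ∑ j, v j ^ 2 = 1) :
    fisherInfo (fun _ => 1 / (k : ℝ)) (outerVec u v) = 1 := by
  rw [fisherInfo_outerVec, ← Finset.mul_sum, ← Finset.sum_div, hu, hv]
  field_simp

theorem IsLocalGrid.sum_trans_eq_one {ι : Type*} {L : ℕ} {v : ι → EuclideanSpace ℝ (Fin k)}
    [Fintype ι] {s : ℝ} {C : (ι × ι → Fin (L + 1)) → MarkovChain k} (hk : 1 ≤ k)
    (hC : IsLocalGrid (fun _ => 1 / (k : ℝ)) (fun l => outerVec (v l.1) (v l.2)) s C)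
    (sum_v : ∀ l, ∑ i, v l i = 0) (θ : ι × ι → Fin (L + 1)) (j : Fin k) :
    ∑ i, (C θ).trans i j = 1 := by
  simp only [hC.trans_apply, Finset.sum_add_distrib]
  rw [← Finset.mul_sum, Finset.sum_comm, (one_div_mem_stdSimplex hk).2]
  simp [outerVec, ← Finset.mul_sum, ← Finset.sum_mul, sum_v]

theorem eventually_le_minimaxWeightedRisk_one_div (hk : 2 ≤ k) (hδ : 0 < δ)
    (hδk : δ < 1 / k) : ∀ᶠ n : ℕ in atTop,
      (1 - 1 / (k : ℝ)) ^ 2 * (((k : ℝ) - k / (k - 1)) / n) ≤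
        minimaxWeightedRisk (MarkovChain.lowerBoundedStat k δ (1 / k)) n := by
  have hk1 : 1 ≤ k := one_le_two.trans hk
  have k_sub_one_pos : (0 : ℝ) < k - 1 := sub_pos.2 (by exact_mod_cast hk)
  have k_sub_two_nonneg : (0 : ℝ) ≤ k - 2 := sub_nonneg.2 (by exact_mod_cast hk)
  obtain ⟨v, hv, sum_v⟩ := exists_orthonormal_sum_eq_zero hk1
  have sum_sq := sum_sq_eq_one_of_orthonormal hv
  have orthonormal_outer := orthonormal_outerVec hv hv
  obtain ⟨L, hL⟩ := exists_isLocalGrid_div_le_expect_directionalRisk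
    (one_div_mem_stdSimplex hk1) (fun _ => by positivity) orthonormal_outer
    (fun l i => by simp only [outerVec, ← Finset.mul_sum, sum_v, mul_zero])
    (κ := fun _ => (k - 2) / (k - 1)) (fun _ => by positivity)
    (fun l => by
      rw [fisherInfo_one_div_outerVec hk1 (sum_sq _) (sum_sq _), mul_one, div_lt_one k_sub_one_pos]
      linarith)
    (sub_pos.2 hδk)
  refine hL.mono fun n ⟨s, C, hC, close, risk_ge⟩ => ?_
  have δ_le (θ) (i j : Fin k) : δ ≤ (C θ).trans i j := by
    linarith [neg_le_of_abs_le (close θ i j)]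
  have stat_eq (θ) :=
    stat_eq_one_div_of_sum_trans_eq_one hδ (δ_le θ) (hC.sum_trans_eq_one hk1 sum_v θ)
  refine le_minimaxWeightedRisk_of_le_expect (C := C) (fun θ => ⟨δ_le θ,
    ⟨⟨0, by omega⟩, stat_eq θ _⟩, Set.forall_mem_range.2 fun j => (stat_eq θ j).ge⟩) fun E => ?_
  calc (1 - 1 / (k : ℝ)) ^ 2 * (((k : ℝ) - k / (k - 1)) / n)
      = 1 / (k : ℝ) * ∑ _l : Fin (k - 1) × Fin (k - 1), (k - 2) / (k - 1) / (n : ℝ) := by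
        simp only [Finset.sum_const, Finset.card_univ, Fintype.card_prod, Fintype.card_fin,
          nsmul_eq_mul, Nat.cast_mul, Nat.cast_sub hk1, Nat.cast_one]
        field_simp
        ring
    _ ≤ 1 / (k : ℝ) * ∑ l : Fin (k - 1) × Fin (k - 1),
          𝔼 θ, directionalRisk (C θ) E (outerVec (v l.1) (v l.2)) := by
        gcongr with l
        exact risk_ge E l
    _ ≤ 1 / (k : ℝ) * 𝔼 θ, ∑ i, stateRisk (C θ) E i := by
        rw [← Finset.expect_sum_comm]
        gcongr with θ
        exact sum_directionalRisk_le_sum_stateRisk orthonormal_outer _ _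
    _ = 𝔼 θ, weightedRisk (C θ) E := by
        simp only [weightedRisk, stat_eq, Finset.mul_expect, Finset.mul_sum]

theorem minimaxWeightedRisk_le_minimaxWorstStateRisk (𝓜 : Set (MarkovChain k)) (n : ℕ) :
    minimaxWeightedRisk 𝓜 n ≤ minimaxWorstStateRisk 𝓜 n := by
  refine ciInf_mono ⟨0, Set.forall_mem_range.2 fun E =>
    Real.iSup_nonneg fun C => weightedRisk_nonneg C.1 E⟩ fun E => ?_
  exact Real.iSup_le (fun C => (weightedRisk_le_worstStateRisk C.1 E).trans
    (le_ciSup (f := fun C : 𝓜 => worstStateRisk C.1 E)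
      ⟨2, Set.forall_mem_range.2 fun C => worstStateRisk_le_two C.1 E⟩ C))
    (Real.iSup_nonneg fun C => worstStateRisk_nonneg C.1 E)

theorem asympLE_minimaxWeightedRisk (hk : 2 ≤ k) (hδ : 0 < δ) (hδk : δ < 1 / k)
    (hδp : δ ≤ pmin) (hpk : pmin ≤ 1 / k) :
    AsympLE (fun n => (1 - pmin) ^ 2 * (((k : ℝ) - k / (k - 1)) / n))
      (minimaxWeightedRisk (MarkovChain.lowerBoundedStat k δ pmin)) := by
  rcases hpk.lt_or_eq with hpk | rfl
  · exact asympLE_of_eventually_le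
      (eventually_le_minimaxWeightedRisk_of_lt hk (hδ.trans_le hδp) hδp hpk)
  · exact asympLE_of_eventually_le (eventually_le_minimaxWeightedRisk_one_div hk hδ hδk)

theorem asympLE_minimaxWorstStateRisk (hk : 2 ≤ k) (hδ : 0 < δ) (hδk : δ < 1 / k)
    (hδp : δ ≤ pmin) (hpk : pmin ≤ 1 / k) :
    AsympLE (fun n => (1 - pmin) ^ 2 * ((1 - 1 / ((k : ℝ) - 1)) / (n * pmin)))
      (minimaxWorstStateRisk (MarkovChain.lowerBoundedStat k δ pmin)) := by
  rcases hpk.lt_or_eq with hpk | rfl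
  · exact asympLE_of_eventually_le
      (eventually_le_minimaxWorstStateRisk_of_lt hk (hδ.trans_le hδp) hδp hpk)
  · refine asympLE_of_eventually_le
      ((eventually_le_minimaxWeightedRisk_one_div hk hδ hδk).mono fun n hn => ?_)
    refine (le_of_eq ?_).trans (hn.trans (minimaxWeightedRisk_le_minimaxWorstStateRisk _ n))
    have : (0 : ℝ) < k - 1 := sub_pos.2 (by exact_mod_cast hk)
    field_simp

end LowerBounds

theorem theorem5 (k : ℕ) (hk : 2 ≤ k) (δ pmin : ℝ) (hδ0 : 0 < δ) (hδk : δ < 1 / (k : ℝ))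
    (hδp : δ ≤ pmin) (hpk : pmin ≤ 1 / (k : ℝ)) :
    (AsympLE (fun n => (1 - pmin) ^ 2 * (((k : ℝ) - (k : ℝ) / ((k : ℝ) - 1)) / (n : ℝ)))
        (minimaxWeightedRisk (MarkovChain.lowerBoundedStat k δ pmin)) ∧
      AsympLE (minimaxWeightedRisk (MarkovChain.lowerBoundedStat k δ pmin))
        (fun n => ((k : ℝ) - 1) / (n : ℝ))) ∧
    (AsympLE (fun n => (1 - pmin) ^ 2 * ((1 - 1 / ((k : ℝ) - 1)) / ((n : ℝ) * pmin)))
        (minimaxWorstStateRisk (MarkovChain.lowerBoundedStat k δ pmin)) ∧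
      AsympLE (minimaxWorstStateRisk (MarkovChain.lowerBoundedStat k δ pmin))
        (fun n => (1 - 1 / (k : ℝ)) / ((n : ℝ) * pmin))) :=
  have subset_lowerBounded : MarkovChain.lowerBoundedStat k δ pmin ⊆
    MarkovChain.lowerBounded k δ := fun _ hC => hC.1
  ⟨⟨asympLE_minimaxWeightedRisk hk hδ0 hδk hδp hpk,
      minimaxWeightedRisk_asympLE hk hδ0 subset_lowerBounded⟩,
    asympLE_minimaxWorstStateRisk hk hδ0 hδk hδp hpk,
    minimaxWorstStateRisk_asympLE hk hδ0 subset_lowerBounded (hδ0.trans_le hδp)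
      fun _ hC i => hC.2.2 ⟨i, rfl⟩⟩
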